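/- Let $h_j\in\mathbb{C}$ be a fixed channel coefficient (under hypothesis $\mathcal{H}_j$, $j\in\{0,1\}$), and let $P_s,\sigma_w,q>0$. Let $s(n)$ and $w(n)$ be independent complex random variables, where $s(n)\sim\mathcal{CN}(0,P_s)$ is circularly symmetric complex Gaussian with $\mathbb{E}|s(n)|^2=P_s$, and $w(n)\sim\mathcal{CML}(0,\sigma_w^2,q)$ is complex circularly symmetric McLeish noise with variance $\mathbb{E}|w(n)|^2=\sigma_w^2$, i.e. it has the density $$f_w(w)=\frac{2\,q^{(q+1)/2}\,|w|^{q-1}}{\pi\,\sigma_w^{q+1}\,\Gamma(q)}\,K_{q-1}\!\left(\frac{2\sqrt{q}}{\sigma_w}|w|\right),\qquad w\in\mathbb{C},$$ with respect to Lebesgue measure, $K_\nu$ being the modified Bessel function of the second kind. Put $\gamma_j=|h_j|^2P_s/\sigma_w^2$. Then all moments below are finite, and the following hold. (i) If $h_j\neq0$ and $p>0$ is a real number that is not an even integer, then $$\mathbb{E}\left[|h_js(n)+w(n)|^p\right]=\frac{\Gamma(1+\frac p2)\,(|h_j|^2P_s)^{p/2}}{\Gamma(q)\,\Gamma(-\frac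 p2)}\;G^{1,2}_{2,1}\!\left(\frac{1}{\gamma_jq}\,\middle|\,\begin{matrix}1-q,\ \frac p2+1\\ 0\end{matrix}\right),$$ where $G^{m,n}_{p,q}$ is the Meijer G-function; here $$G^{1,2}_{2,1}\!\left(z\,\middle|\,\begin{matrix}a_1,\ a_2\\ b_1\end{matrix}\right)=\frac{1}{2\pi i}\int_{\mathcal L}\Gamma(b_1-u)\,\Gamma(1-a_1+u)\,\Gamma(1-a_2+u)\,z^u\,du ,$$ with $\mathcal L$ a contour from $-i\infty$ to $+i\infty$ that has the poles of $\Gamma(b_1-u)$ on its right and those of $\Gamma(1-a_1+u)$ and $\Gamma(1-a_2+u)$ on its left. (ii) If $p\geq2$ is an even integer, then $$\mathbb{E}\left[|h_js(n)+w(n)|^p\right]=\frac{\Gamma(1+\frac p2)}{\Gamma(q)}\sum_{k=0}^{p/2}\binom{p/2}{k}\left(|h_j|^2P_s\right)^{\frac p2-k}\sigma_w^{2k}\,\Gamma(k+q)\,q^{-k}.$$ -/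

import Mathlib

open MeasureTheory ProbabilityTheory
open scoped NNReal ENNReal

noncomputable section

/-- The circularly symmetric complex Gaussian law `CN(0, v)` of total variance `v`: real and
imaginary parts are independent real Gaussians of mean `0` and variance `v / 2`. -/
def complexGaussian (v : ℝ≥0) : Measure ℂ :=
  ((gaussianReal 0 (v / 2)).prod (gaussianReal 0 (v / 2))).map
    (fun x : ℝ × ℝ => (⟨x.1, x.2⟩ : ℂ))

/-- The modified Bessel function of the second kind of real order `ν`, for `x > 0`:
`K_ν(x) = (1/2) (x/2)^ν ∫_0^∞ t^(-ν-1) exp(-t - x²/(4t)) dt`. -/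
def besselK (ν x : ℝ) : ℝ :=
  1 / 2 * (x / 2) ^ ν *
    ∫ t in Set.Ioi (0 : ℝ), t ^ (-ν - 1) * Real.exp (-t - x ^ 2 / (4 * t))

/-- The density on `ℂ` of the complex circularly symmetric McLeish law `CML(0, σ², q)`, where `σ²`
is the total variance and `q` the non-Gaussianity parameter. -/
def mcLeishPDF (σ q : ℝ) (w : ℂ) : ℝ :=
  2 * q ^ ((q + 1) / 2) * ‖w‖ ^ (q - 1) / (Real.pi * σ ^ (q + 1) * Real.Gamma q) *
    besselK (q - 1) (2 * Real.sqrt q / σ * ‖w‖)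

/-- The complex circularly symmetric McLeish law `CML(0, σ², q)`. -/
def mcLeish (σ q : ℝ) : Measure ℂ :=
  (volume : Measure ℂ).withDensity (fun w => ENNReal.ofReal (mcLeishPDF σ q w))

section MeijerG

variable {p q : ℕ}

/-- The integrand of the Meijer G-function `G^{m,n}_{p,q}(z | a_1,…,a_p ; b_1,…,b_q)`:
`∏_{j ≤ m} Γ(b_j - s) ∏_{k ≤ n} Γ(1 - a_k + s) z^s`
divided by `∏_{j > m} Γ(1 - b_j + s) ∏_{k > n} Γ(a_k - s)`. -/
def meijerIntegrand (m n : ℕ) (a : Fin p → ℂ) (b : Fin q → ℂ) (z s : ℂ) : ℂ :=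
  (∏ j : Fin q, if (j : ℕ) < m then Complex.Gamma (b j - s)
      else (Complex.Gamma (1 - b j + s))⁻¹) *
    (∏ k : Fin p, if (k : ℕ) < n then Complex.Gamma (1 - a k + s)
      else (Complex.Gamma (a k - s))⁻¹) * z ^ s

/-- The poles of `Γ(1 - a_k + s)`, `k ≤ n`, which have to lie to the left of the contour. -/
def meijerLeftPoles (n : ℕ) (a : Fin p → ℂ) : Set ℂ :=
  {s | ∃ k : Fin p, (k : ℕ) < n ∧ ∃ l : ℕ, s = a k - 1 - l}

/-- The poles of `Γ(b_j - s)`, `j ≤ m`, which have to lie to the right of the contour. -/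
def meijerRightPoles (m : ℕ) (b : Fin q → ℂ) : Set ℂ :=
  {s | ∃ j : Fin q, (j : ℕ) < m ∧ ∃ l : ℕ, s = b j + l}

/-- A contour from `-i∞` to `+i∞` that has every point of `L` on its left and every point of `R` on
its right. It runs along a vertical line `Re s = c` to the right of `L`, and it goes once clockwise
around each of the (finitely many) points of `R` with `Re s < c`, along a small circle which
isolates that point from the rest of `L ∪ R`; in this way these points end up on its right. (The
straight segments that join the line with the circles are traversed in both directions and
cancel.) -/
structure MeijerContour (L R : Set ℂ) where
  /-- abscissa of the vertical line -/
  c : ℝ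
  left_lt : ∀ s ∈ L, s.re < c
  right_ne : ∀ s ∈ R, s.re ≠ c
  /-- the points of `R` that lie to the left of the vertical line -/
  enclosed : Finset ℂ
  mem_enclosed : ∀ s, s ∈ enclosed ↔ s ∈ R ∧ s.re < c
  /-- common radius of the circles -/
  r : ℝ
  r_pos : 0 < r
  isolated_left : ∀ s ∈ enclosed, ∀ u ∈ L, r < dist u s
  isolated_right : ∀ s ∈ enclosed, ∀ u ∈ R, u ≠ s → r < dist u s

/-- The integral `(1 / (2πi)) ∫ F(s) ds` along the contour. -/
def MeijerContour.integral {L R : Set ℂ} (K : MeijerContour L R) (F : ℂ → ℂ) : ℂ :=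
  (2 * Real.pi * Complex.I)⁻¹ *
    ((∫ y : ℝ, F (K.c + y * Complex.I) * Complex.I) - ∑ s ∈ K.enclosed, ∮ u in C(s, K.r), F u)

open Classical in
/-- The Meijer G-function `G^{m,n}_{p,q}(z | a ; b)`, as the absolutely convergent Mellin-Barnes
integral along a contour from `-i∞` to `+i∞` that separates the two families of poles (by Cauchy's
theorem the value does not depend on the contour). The value is `0` if there is no separating
contour with an absolutely convergent integral. -/
def meijerG (m n : ℕ) (a : Fin p → ℂ) (b : Fin q → ℂ) (z : ℂ) : ℂ :=
  if h : ∃ K : MeijerContour (meijerLeftPoles n a) (meijerRightPoles m b),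
      Complex.VerticalIntegrable (meijerIntegrand m n a b z) K.c
  then h.choose.integral (meijerIntegrand m n a b z) else 0

end MeijerG

end

/-! ### The complex Gaussian law -/

/-! McLeish noise is complex Gaussian noise with a random variance `σ² g / q`, where `g` is
`Gamma(q, 1)` distributed (`lintegral_mcLeish`). Given `g`, the sum `h s + w` is complex Gaussian of
variance `|h|² P + σ² g / q`, so its `p`-th absolute moment is `Γ(1 + p/2)` times the variance to
the power `p/2`. Hence every moment is a Gamma average of `(A + c g)^(p/2)` (`moment_norm_add`), and
for even `p` the binomial theorem finishes.

Otherwise put `b = p/2`. It remains to identify the average of `(1 + x g)^b` with a Mellin-Barnes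
integral (`meijerG_eq_integral`). As `b > 0`, no vertical line separates the left pole `b` from the
right pole `0`, so the contour is a line `Re s = c > b` together with clockwise circles around `0,
…, N`, where `N < c < N + 1`. This mirrors Taylor's formula for `(1 + y)^b` at `0`: on the line the
integrand is, up to a constant, the Mellin transform of the averaged Taylor remainder
(`hasMellin_gammaRemainder`), which Mellin inversion recovers (`integral_barnesKernel`), and the
circles contribute the averaged Taylor polynomial (`circleIntegral_barnesKernel`). The Mellin
transforms come from one rule for multiplicative convolutions, `HasMellin.integral_mul_comp_mul`. -/

theorem measurable_complexMk : Measurable (fun x : ℝ × ℝ => (⟨x.1, x.2⟩ : ℂ)) :=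
  Complex.measurableEquivRealProd.symm.measurable

instance isProbabilityMeasure_complexGaussian (v : ℝ≥0) :
    IsProbabilityMeasure (complexGaussian v) :=
  Measure.isProbabilityMeasure_map measurable_complexMk.aemeasurable

theorem charFun_complexGaussian (v : ℝ≥0) (t : ℂ) :
    charFun (complexGaussian v) t = Complex.exp (-(v * ‖t‖ ^ 2 / 4 : ℝ)) := by
  have key : ∀ x : ℝ × ℝ, Complex.exp ((inner ℝ (⟨x.1, x.2⟩ : ℂ) t : ℝ) * Complex.I) =
      Complex.exp (t.re * x.1 * Complex.I) * Complex.exp (t.im * x.2 * Complex.I) := by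
    intro x
    rw [← Complex.exp_add]
    congr 1
    rw [Complex.inner]
    simp [Complex.mul_re]
    ring
  rw [charFun_apply, complexGaussian, integral_map measurable_complexMk.aemeasurable
    (by fun_prop)]
  simp_rw [key]
  rw [integral_prod_mul (fun x : ℝ => Complex.exp (t.re * x * Complex.I))
    (fun x : ℝ => Complex.exp (t.im * x * Complex.I)), ← charFun_apply_real, ← charFun_apply_real,
    charFun_gaussianReal, charFun_gaussianReal, ← Complex.exp_add]
  congr 1
  rw [Complex.sq_norm, Complex.normSq_apply]
  push_cast
  ring

theorem charFun_map_const_mul (ρ : Measure ℂ) (h t : ℂ) :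
    charFun (ρ.map (h * ·)) t = charFun ρ ((starRingEnd ℂ) h * t) := by
  rw [charFun_apply, charFun_apply, integral_map (by fun_prop) (by fun_prop)]
  congr 1
  ext x
  simp only [Complex.inner, map_mul]
  congr 4
  ring

/-- Compare characteristic functions: multiplication by `h` acts on the frequency as multiplication
by its conjugate, and only the norm of the frequency enters. -/
theorem complexGaussian_map_mul_conv (h : ℂ) (P v : ℝ≥0) :
    ((complexGaussian P).map (h * ·)) ∗ complexGaussian v =
      complexGaussian (‖h‖₊ ^ 2 * P + v) := by
  have : IsProbabilityMeasure ((complexGaussian P).map (h * ·)) :=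
    Measure.isProbabilityMeasure_map (by fun_prop)
  refine Measure.ext_of_charFun ?_
  ext t
  rw [charFun_conv, charFun_map_const_mul]
  simp only [charFun_complexGaussian]
  rw [← Complex.exp_add]
  congr 1
  simp only [norm_mul, RCLike.norm_conj]
  push_cast
  ring

theorem lintegral_complexGaussian {v : ℝ≥0} (hv : v ≠ 0) {f : ℂ → ℝ≥0∞} (hf : Measurable f) :
    ∫⁻ z, f z ∂complexGaussian v =
      ∫⁻ z, ENNReal.ofReal ((Real.pi * v)⁻¹ * Real.exp (-‖z‖ ^ 2 / v)) * f z := by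
  have hv2 : v / 2 ≠ 0 := by positivity
  rw [complexGaussian, lintegral_map hf measurable_complexMk, gaussianReal_of_var_ne_zero _ hv2,
    prod_withDensity (measurable_gaussianPDF _ _) (measurable_gaussianPDF _ _),
    lintegral_withDensity_eq_lintegral_mul _ (by fun_prop)
      (show Measurable fun x : ℝ × ℝ => f ⟨x.1, x.2⟩ from hf.comp measurable_complexMk),
    ← Complex.volume_preserving_equiv_real_prod.symm.lintegral_comp_emb
      Complex.measurableEquivRealProd.symm.measurableEmbedding]
  refine lintegral_congr fun x => ?_
  have hv0 : (0 : ℝ) < v := by positivity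
  simp only [Pi.mul_apply, Complex.measurableEquivRealProd_symm_apply]
  congr 1
  rw [gaussianPDF, gaussianPDF, ← ENNReal.ofReal_mul (gaussianPDFReal_nonneg _ _ _)]
  congr 1
  rw [gaussianPDFReal, gaussianPDFReal, Complex.sq_norm, Complex.normSq_apply]
  have h1 : (2 : ℝ) * Real.pi * ((v / 2 : ℝ≥0) : ℝ) = Real.pi * v := by
    push_cast; ring
  rw [h1, mul_mul_mul_comm, ← mul_inv, Real.mul_self_sqrt (by positivity), ← Real.exp_add]
  congr 2
  push_cast
  field_simp
  ring

theorem lintegral_norm_rpow_complexGaussian {v : ℝ≥0} (hv : v ≠ 0) {p : ℝ} (hp : 0 < p) :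
    ∫⁻ z, ENNReal.ofReal (‖z‖ ^ p) ∂complexGaussian v =
      ENNReal.ofReal (Real.Gamma (1 + p / 2) * (v : ℝ) ^ (p / 2)) := by
  have hv0 : (0 : ℝ) < v := by positivity
  rw [lintegral_complexGaussian hv (by fun_prop)]
  have hI := Complex.integral_rpow_mul_exp_neg_mul_rpow (p := 2) (q := p) (b := (v : ℝ)⁻¹)
    (by norm_num) (by linarith) (by positivity)
  have hval : (2 * Real.pi / 2) * (v : ℝ)⁻¹ ^ (-(p + 2) / 2) * Real.Gamma ((p + 2) / 2) =
      Real.pi * v * (Real.Gamma (1 + p / 2) * (v : ℝ) ^ (p / 2)) := by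
    rw [Real.inv_rpow hv0.le, ← Real.rpow_neg hv0.le,
      show -(-(p + 2) / 2) = p / 2 + 1 by ring, Real.rpow_add_one hv0.ne',
      show (p + 2) / 2 = 1 + p / 2 by ring]
    ring
  rw [hval] at hI
  have hpos : 0 < Real.pi * v * (Real.Gamma (1 + p / 2) * (v : ℝ) ^ (p / 2)) := by
    have := Real.Gamma_pos_of_pos (show 0 < 1 + p / 2 by linarith)
    positivity
  -- A non-integrable function would have integral `0` by convention, but the value found is
  -- positive.
  have hint : Integrable (fun x : ℂ => ‖x‖ ^ p * Real.exp (-(v : ℝ)⁻¹ * ‖x‖ ^ (2 : ℝ))) := by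
    by_contra hcon
    rw [integral_undef hcon] at hI
    exact hpos.ne hI
  rw [show Real.Gamma (1 + p / 2) * (v : ℝ) ^ (p / 2) = (Real.pi * v)⁻¹ *
    ∫ x : ℂ, ‖x‖ ^ p * Real.exp (-(v : ℝ)⁻¹ * ‖x‖ ^ (2 : ℝ)) by rw [hI]; field_simp,
    ← integral_const_mul, ofReal_integral_eq_lintegral_ofReal (hint.const_mul _)
      (.of_forall fun x => by positivity)]
  refine lintegral_congr fun x => ?_
  rw [← ENNReal.ofReal_mul (by positivity)]
  congr 1
  rw [Real.rpow_two, show -(v : ℝ)⁻¹ * ‖x‖ ^ 2 = -‖x‖ ^ 2 / v by ring]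
  ring

/-! ### The McLeish law as a Gamma mixture of complex Gaussian laws -/

/-- Raise `x ≤ exp x` at `x = B / (t q)` to the power `q`. This tames the singularity of the Bessel
integrand at `t = 0`. -/
theorem rpow_neg_mul_exp_neg_div_le {q B t : ℝ} (hq : 0 < q) (hB : 0 < B) (ht : 0 < t) :
    t ^ (-q) * Real.exp (-(B / t)) ≤ (q / B) ^ q := by
  have h1 : B / t / q ≤ Real.exp (B / t / q) := by
    linarith [Real.add_one_le_exp (B / t / q)]
  have h2 := Real.rpow_le_rpow (by positivity) h1 hq.le
  rw [← Real.exp_mul, div_mul_cancel₀ _ hq.ne'] at h2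
  have h3 : B / t / q = (q / B)⁻¹ * t⁻¹ := by field_simp
  rw [h3, Real.mul_rpow (by positivity) (by positivity), Real.inv_rpow ht.le,
    Real.inv_rpow (by positivity), ← Real.rpow_neg ht.le] at h2
  rw [Real.exp_neg, ← div_eq_mul_inv, div_le_iff₀ (Real.exp_pos _)]
  rwa [inv_mul_le_iff₀ (by positivity)] at h2

theorem integrableOn_rpow_mul_exp_neg_sub_div {q B : ℝ} (hq : 0 < q) (hB : 0 < B) :
    IntegrableOn (fun t : ℝ => t ^ (-q) * Real.exp (-t - B / t)) (Set.Ioi 0) := by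
  have hexp : IntegrableOn (fun t : ℝ => (q / B) ^ q * Real.exp (-t)) (Set.Ioi 0) :=
    (integrableOn_exp_neg_Ioi 0).const_mul _
  refine hexp.mono' (by fun_prop) ?_
  filter_upwards [self_mem_ae_restrict measurableSet_Ioi] with t ht
  have ht : 0 < t := ht
  rw [Real.norm_of_nonneg (by positivity), sub_eq_neg_add, Real.exp_add, ← mul_assoc]
  exact mul_le_mul_of_nonneg_right (rpow_neg_mul_exp_neg_div_le hq hB ht) (Real.exp_pos _).le

/-- The density of the mixing variable, a `Gamma(q, 1)` law. -/
noncomputable def gammaWeight (q g : ℝ) : ℝ := g ^ (q - 1) * Real.exp (-g) / Real.Gamma q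

theorem measurable_gammaWeight (q : ℝ) : Measurable (gammaWeight q) := by
  unfold gammaWeight; fun_prop

theorem gammaWeight_nonneg {q g : ℝ} (hq : 0 < q) (hg : 0 < g) : 0 ≤ gammaWeight q g := by
  have := Real.Gamma_pos_of_pos hq
  unfold gammaWeight; positivity

/-- The substitution `t = B / g`, done as a scaling followed by an inversion. It exchanges the two
terms of the exponent, so that `exp (-g)` becomes the Gamma factor and `exp (-B / g)` the Gaussian
one. -/
theorem integral_rpow_mul_exp_neg_sub_div {q B : ℝ} (hB : 0 < B) :
    ∫ t in Set.Ioi (0 : ℝ), t ^ (-q) * Real.exp (-t - B / t) =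
      B ^ (1 - q) * ∫ g in Set.Ioi (0 : ℝ), g ^ (q - 2) * Real.exp (-g - B / g) := by
  have h1 := integral_comp_mul_left_Ioi
    (fun t : ℝ => t ^ (-q) * Real.exp (-t - B / t)) 0 hB
  have h2 := integral_comp_rpow_Ioi
    (fun t : ℝ => (B * t) ^ (-q) * Real.exp (-(B * t) - B / (B * t))) (p := -1) (by norm_num)
  rw [mul_zero] at h1
  have h3 : ∫ t in Set.Ioi (0 : ℝ), t ^ (-q) * Real.exp (-t - B / t) =
      B * ∫ t in Set.Ioi (0 : ℝ), (B * t) ^ (-q) * Real.exp (-(B * t) - B / (B * t)) := by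
    rw [h1, smul_eq_mul]; field_simp
  rw [h3, ← h2, ← integral_const_mul, ← integral_const_mul]
  refine setIntegral_congr_fun measurableSet_Ioi fun g hg => ?_
  have hg : 0 < g := hg
  simp only [smul_eq_mul, Real.rpow_neg_one, abs_neg, abs_one, one_mul]
  rw [Real.mul_rpow hB.le (by positivity), Real.inv_rpow hg.le, Real.rpow_neg hg.le q, inv_inv,
    show -(B * g⁻¹) - B / (B * g⁻¹) = -g - B / g by field_simp; ring,
    show (1 : ℝ) - q = -q + 1 by ring, Real.rpow_add_one hB.ne',
    show (-1 : ℝ) - 1 = -2 by ring, show q - 2 = q + -2 by ring, Real.rpow_add hg]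
  ring

/-- With `B = q |w|² / σ²` the Bessel argument is `2 √B`, and `B / g` is the exponent of the
Gaussian density of variance `σ² g / q`. The rest is bookkeeping of powers. -/
theorem mcLeishPDF_eq_integral {σ q : ℝ} (hσ : 0 < σ) (hq : 0 < q) {w : ℂ} (hw : w ≠ 0) :
    ENNReal.ofReal (mcLeishPDF σ q w) = ∫⁻ g in Set.Ioi (0 : ℝ),
      ENNReal.ofReal (gammaWeight q g) *
        ENNReal.ofReal ((Real.pi * (σ ^ 2 * g / q))⁻¹ *
          Real.exp (-‖w‖ ^ 2 / (σ ^ 2 * g / q))) := by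
  have hn : 0 < ‖w‖ := norm_pos_iff.2 hw
  have hΓ := Real.Gamma_pos_of_pos hq
  set B : ℝ := q * ‖w‖ ^ 2 / σ ^ 2 with hBdef
  have hB : 0 < B := by positivity
  have hx : (2 * Real.sqrt q / σ * ‖w‖) ^ 2 = 4 * B := by
    rw [hBdef, mul_pow, div_pow, mul_pow, Real.sq_sqrt hq.le]; ring
  have hBq : (2 * Real.sqrt q / σ * ‖w‖ / 2) = B ^ (1 / 2 : ℝ) := by
    rw [← Real.sqrt_eq_rpow, eq_comm, Real.sqrt_eq_iff_mul_self_eq (by positivity) (by positivity)]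
    linear_combination -(1 / 4) * hx
  have hbes : besselK (q - 1) (2 * Real.sqrt q / σ * ‖w‖) =
      1 / 2 * (B ^ (1 / 2 : ℝ)) ^ (q - 1) * (B ^ (1 - q) *
        ∫ g in Set.Ioi (0 : ℝ), g ^ (q - 2) * Real.exp (-g - B / g)) := by
    rw [← integral_rpow_mul_exp_neg_sub_div hB, besselK, hBq]
    congr 1
    refine setIntegral_congr_fun measurableSet_Ioi fun t ht => ?_
    have ht : 0 < t := ht
    rw [hx, show -(q - 1) - 1 = -q by ring, show 4 * B / (4 * t) = B / t by field_simp]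
  -- Integrability is carried over from the variable `t`: otherwise the substitution formula would
  -- equate a positive integral with the default value `0`.
  have hint : IntegrableOn (fun g : ℝ => g ^ (q - 2) * Real.exp (-g - B / g)) (Set.Ioi 0) := by
    by_contra hcon
    have h0 := integral_rpow_mul_exp_neg_sub_div (q := q) hB
    rw [integral_undef hcon, mul_zero] at h0
    have hpos : 0 < ∫ t in Set.Ioi (0 : ℝ), t ^ (-q) * Real.exp (-t - B / t) := by
      rw [setIntegral_pos_iff_support_of_nonneg_ae]
      · rw [Set.inter_eq_right.2]
        · simp
        · intro t ht
          have ht : 0 < t := ht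
          simp only [Function.mem_support]
          positivity
      · filter_upwards [self_mem_ae_restrict measurableSet_Ioi] with t ht
        have ht : 0 < t := ht
        simp only [Pi.zero_apply]
        positivity
      · exact integrableOn_rpow_mul_exp_neg_sub_div hq hB
    exact hpos.ne' h0
  have hconst : mcLeishPDF σ q w = q / (Real.pi * σ ^ 2 * Real.Gamma q) *
      ∫ g in Set.Ioi (0 : ℝ), g ^ (q - 2) * Real.exp (-g - B / g) := by
    rw [mcLeishPDF, hbes]
    have e1 : (B ^ (1 / 2 : ℝ)) ^ (q - 1) * B ^ (1 - q) = (B ^ (1 / 2 : ℝ)) ^ (1 - q) := by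
      rw [← Real.rpow_mul hB.le, ← Real.rpow_mul hB.le, ← Real.rpow_add hB]
      congr 1; ring
    have e2 : B ^ (1 / 2 : ℝ) = q ^ (1 / 2 : ℝ) * ‖w‖ / σ := by
      rw [← hBq, ← Real.sqrt_eq_rpow]; ring
    have e3 : (B ^ (1 / 2 : ℝ)) ^ (1 - q) =
        q ^ ((1 - q) / 2) * ‖w‖ ^ (1 - q) / σ ^ (1 - q) := by
      rw [e2, Real.div_rpow (by positivity) hσ.le, Real.mul_rpow (by positivity) hn.le,
        ← Real.rpow_mul hq.le]
      congr 3; ring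
    have e4 : q ^ ((q + 1) / 2) * q ^ ((1 - q) / 2) = q := by
      rw [← Real.rpow_add hq]; ring_nf; exact Real.rpow_one q
    have e5 : ‖w‖ ^ (q - 1) * ‖w‖ ^ (1 - q) = 1 := by
      rw [← Real.rpow_add hn]; ring_nf; exact Real.rpow_zero _
    have e6 : σ ^ (q + 1) * σ ^ (1 - q) = σ ^ 2 := by
      rw [← Real.rpow_add hσ, ← Real.rpow_two]; ring_nf
    set J := ∫ g in Set.Ioi (0 : ℝ), g ^ (q - 2) * Real.exp (-g - B / g)
    calc _ = q ^ ((q + 1) / 2) * ‖w‖ ^ (q - 1) / (Real.pi * σ ^ (q + 1) * Real.Gamma q) *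
          ((B ^ (1 / 2 : ℝ)) ^ (q - 1) * B ^ (1 - q)) * J := by ring
      _ = (q ^ ((q + 1) / 2) * q ^ ((1 - q) / 2)) * (‖w‖ ^ (q - 1) * ‖w‖ ^ (1 - q)) /
          (Real.pi * (σ ^ (q + 1) * σ ^ (1 - q)) * Real.Gamma q) * J := by
          rw [e1, e3]; field_simp
      _ = _ := by rw [e4, e5, e6, mul_one]
  rw [hconst, ← integral_const_mul, ofReal_integral_eq_lintegral_ofReal (hint.const_mul _)
    (by
      filter_upwards [self_mem_ae_restrict measurableSet_Ioi] with t ht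
      have ht : 0 < t := ht
      simp only [Pi.zero_apply]
      positivity)]
  refine setLIntegral_congr_fun measurableSet_Ioi fun g hg => ?_
  have hg : 0 < g := hg
  rw [← ENNReal.ofReal_mul (gammaWeight_nonneg hq hg)]
  congr 1
  rw [gammaWeight, sub_eq_add_neg (-g), Real.exp_add,
    show -(B / g) = -‖w‖ ^ 2 / (σ ^ 2 * g / q) by rw [hBdef]; field_simp,
    show q - 1 = q - 2 + 1 by ring, Real.rpow_add_one hg.ne']
  field_simp

theorem lintegral_mcLeish {σ q : ℝ} (hσ : 0 < σ) (hq : 0 < q) {f : ℂ → ℝ≥0∞}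
    (hf : Measurable f) :
    ∫⁻ w, f w ∂mcLeish σ q = ∫⁻ g in Set.Ioi (0 : ℝ), ENNReal.ofReal (gammaWeight q g) *
      ∫⁻ w, f w ∂complexGaussian (Real.toNNReal (σ ^ 2 * g / q)) := by
  set D : ℂ → ℝ → ℝ≥0∞ := fun w g => ENNReal.ofReal (gammaWeight q g) *
        ENNReal.ofReal ((Real.pi * (σ ^ 2 * g / q))⁻¹ *
          Real.exp (-‖w‖ ^ 2 / (σ ^ 2 * g / q))) with hD
  have hDm : Measurable (Function.uncurry D) := by
    have := measurable_gammaWeight q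
    simp only [hD, Function.uncurry_def]
    fun_prop
  have hae : (fun w => ENNReal.ofReal (mcLeishPDF σ q w)) =ᵐ[volume]
      fun w => ∫⁻ g in Set.Ioi (0 : ℝ), D w g := by
    filter_upwards [Measure.ae_ne volume (0 : ℂ)] with w hw
    exact mcLeishPDF_eq_integral hσ hq hw
  rw [mcLeish, withDensity_congr_ae hae,
    lintegral_withDensity_eq_lintegral_mul _ hDm.lintegral_prod_right hf]
  have h1 : ∀ w, ((fun w => ∫⁻ g in Set.Ioi (0 : ℝ), D w g) * f) w =
      ∫⁻ g in Set.Ioi (0 : ℝ), D w g * f w := fun w => by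
    rw [Pi.mul_apply, lintegral_mul_const _ (by fun_prop)]
  simp_rw [h1]
  rw [lintegral_lintegral_swap (hDm.mul (hf.comp measurable_fst)).aemeasurable]
  refine setLIntegral_congr_fun measurableSet_Ioi fun g hg => ?_
  have hg : 0 < g := hg
  have hv : (0 : ℝ) < σ ^ 2 * g / q := by positivity
  rw [lintegral_complexGaussian (by simpa using hv) hf, Real.coe_toNNReal _ hv.le,
    ← lintegral_const_mul _ (by fun_prop)]
  simp only [hD, mul_assoc]

/-! ### The moments as a Gamma average -/

section Moments

variable {Ω : Type*} [MeasurableSpace Ω] {μ : Measure Ω} [IsProbabilityMeasure μ]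

theorem lintegral_complexGaussian_add (h : ℂ) (P v : ℝ≥0) {f : ℂ → ℝ≥0∞} (hf : Measurable f) :
    ∫⁻ a, ∫⁻ b, f (h * a + b) ∂complexGaussian v ∂complexGaussian P =
      ∫⁻ z, f z ∂complexGaussian (‖h‖₊ ^ 2 * P + v) := by
  rw [← complexGaussian_map_mul_conv, Measure.lintegral_conv hf,
    lintegral_map (f := fun x => ∫⁻ y, f (x + y) ∂complexGaussian v) ?_ (by fun_prop)]
  exact Measurable.lintegral_prod_right' (f := fun x : ℂ × ℂ => f (x.1 + x.2)) (by fun_prop)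

/-- By Tonelli the average over the mixing variable is taken last; for fixed `g` the sum is complex
Gaussian. -/
theorem lintegral_norm_rpow_add {h : ℂ} {P : ℝ≥0} {σ q : ℝ} (hσ : 0 < σ) (hq : 0 < q)
    {s w : Ω → ℂ} (hs : HasLaw s (complexGaussian P) μ) (hw : HasLaw w (mcLeish σ q) μ)
    (hsw : IndepFun s w μ) {p : ℝ} (hp : 0 < p) :
    ∫⁻ ω, ENNReal.ofReal (‖h * s ω + w ω‖ ^ p) ∂μ =
      ∫⁻ g in Set.Ioi (0 : ℝ), ENNReal.ofReal (gammaWeight q g *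
        (Real.Gamma (1 + p / 2) * (‖h‖ ^ 2 * P + σ ^ 2 * g / q) ^ (p / 2))) := by
  set f : ℂ → ℝ≥0∞ := fun z => ENNReal.ofReal (‖z‖ ^ p)
  have hf : Measurable f := by fun_prop
  -- The total mass needs no computation, since the measure is the law of `w`.
  have hprob : IsProbabilityMeasure (mcLeish σ q) := by
    rw [← hw.map_eq]; exact Measure.isProbabilityMeasure_map hw.aemeasurable
  have hmap : μ.map (fun ω => (s ω, w ω)) = (complexGaussian P).prod (mcLeish σ q) := by
    rw [(indepFun_iff_map_prod_eq_prod_map_map hs.aemeasurable hw.aemeasurable).1 hsw,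
      hs.map_eq, hw.map_eq]
  have h1 : ∫⁻ ω, f (h * s ω + w ω) ∂μ =
      ∫⁻ a, ∫⁻ b, f (h * a + b) ∂mcLeish σ q ∂complexGaussian P := by
    rw [← lintegral_prod (fun x : ℂ × ℂ => f (h * x.1 + x.2)) (by fun_prop), ← hmap,
      lintegral_map' (by fun_prop) (hs.aemeasurable.prodMk hw.aemeasurable)]
  change ∫⁻ ω, f (h * s ω + w ω) ∂μ = _
  have h2 : ∀ a, ∫⁻ b, f (h * a + b) ∂mcLeish σ q = ∫⁻ g in Set.Ioi (0 : ℝ),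
      ENNReal.ofReal (gammaWeight q g) *
        ∫⁻ b, f (h * a + b) ∂complexGaussian (Real.toNNReal (σ ^ 2 * g / q)) :=
    fun a => lintegral_mcLeish hσ hq (by fun_prop)
  -- Explicit densities replace the `g`-dependent measures, which makes joint measurability in `(a,
  -- g)` evident for the swap.
  set Γd : ℂ → ℝ → ℂ → ℝ≥0∞ := fun a g b => ENNReal.ofReal (gammaWeight q g) *
      (ENNReal.ofReal ((Real.pi * (σ ^ 2 * g / q))⁻¹ *
          Real.exp (-‖b‖ ^ 2 / (σ ^ 2 * g / q))) * f (h * a + b)) with hΓd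
  have hw' := measurable_gammaWeight q
  have h3 : ∀ a, ∀ g ∈ Set.Ioi (0 : ℝ), ENNReal.ofReal (gammaWeight q g) *
        ∫⁻ b, f (h * a + b) ∂complexGaussian (Real.toNNReal (σ ^ 2 * g / q)) =
        ∫⁻ b, Γd a g b := by
    intro a g hg
    have hg : 0 < g := hg
    have hv : (0 : ℝ) < σ ^ 2 * g / q := by positivity
    rw [lintegral_complexGaussian (by simpa using hv) (by fun_prop), Real.coe_toNNReal _ hv.le,
      ← lintegral_const_mul _ (by fun_prop)]
  have hΓm : Measurable fun x : ℂ × ℝ => ∫⁻ b, Γd x.1 x.2 b := by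
    refine Measurable.lintegral_prod_right' (f := fun y : (ℂ × ℝ) × ℂ => Γd y.1.1 y.1.2 y.2) ?_
    simp only [hΓd]
    fun_prop
  rw [h1]
  rw [lintegral_congr fun a => (h2 a).trans (setLIntegral_congr_fun measurableSet_Ioi (h3 a))]
  rw [lintegral_lintegral_swap hΓm.aemeasurable]
  refine setLIntegral_congr_fun measurableSet_Ioi fun g hg => ?_
  have h3' := fun a => (h3 a g hg).symm
  have hg : 0 < g := hg
  have hv : (0 : ℝ) < σ ^ 2 * g / q := by positivity
  refine (lintegral_congr h3').trans ?_
  rw [lintegral_const_mul, lintegral_complexGaussian_add h P _ hf,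
    lintegral_norm_rpow_complexGaussian _ hp, ← ENNReal.ofReal_mul (gammaWeight_nonneg hq hg)]
  · congr 3
    push_cast
    rw [Real.coe_toNNReal _ hv.le]
  · exact (add_pos_of_nonneg_of_pos (by positivity) (by simpa using hv)).ne'
  · exact Measurable.lintegral_prod_right' (f := fun x : ℂ × ℂ => f (h * x.1 + x.2)) (by fun_prop)

/-- Since `A + c g` is at most twice the larger summand, two Gamma integrals dominate. -/
theorem integrableOn_gammaWeight_mul_rpow {q A c b : ℝ} (hq : 0 < q) (hA : 0 ≤ A) (hc : 0 ≤ c)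
    (hb : 0 ≤ b) :
    IntegrableOn (fun g => gammaWeight q g * (A + c * g) ^ b) (Set.Ioi 0) := by
  have hΓ := Real.Gamma_pos_of_pos hq
  have h1 := ((Real.GammaIntegral_convergent hq).const_mul ((2 * A) ^ b / Real.Gamma q)).add
    ((Real.GammaIntegral_convergent (add_pos_of_pos_of_nonneg hq hb)).const_mul
      ((2 * c) ^ b / Real.Gamma q))
  have hw' := measurable_gammaWeight q
  refine h1.mono' (by fun_prop) ?_
  filter_upwards [self_mem_ae_restrict measurableSet_Ioi] with g hg
  have hg : 0 < g := hg
  rw [Real.norm_of_nonneg (mul_nonneg (gammaWeight_nonneg hq hg) (by positivity))]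
  have h2 : (A + c * g) ^ b ≤ (2 * A) ^ b + (2 * c) ^ b * g ^ b := by
    rw [← Real.mul_rpow (by positivity) hg.le]
    rcases le_total A (c * g) with h | h
    · refine (Real.rpow_le_rpow (by positivity) (show _ ≤ 2 * c * g by linarith) hb).trans ?_
      exact le_add_of_nonneg_left (by positivity)
    · refine (Real.rpow_le_rpow (by positivity) (show _ ≤ 2 * A by linarith) hb).trans ?_
      exact le_add_of_nonneg_right (by positivity)
  refine (mul_le_mul_of_nonneg_left h2 (gammaWeight_nonneg hq hg)).trans_eq ?_
  simp only [Pi.add_apply]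
  rw [gammaWeight, show q + b - 1 = q - 1 + b by ring, Real.rpow_add hg]
  ring

theorem moment_norm_add {h : ℂ} {P : ℝ≥0} {σ q : ℝ} (hσ : 0 < σ) (hq : 0 < q)
    {s w : Ω → ℂ} (hs : HasLaw s (complexGaussian P) μ) (hw : HasLaw w (mcLeish σ q) μ)
    (hsw : IndepFun s w μ) {p : ℝ} (hp : 0 < p) :
    Integrable (fun ω => ‖h * s ω + w ω‖ ^ p) μ ∧
      ∫ ω, ‖h * s ω + w ω‖ ^ p ∂μ = Real.Gamma (1 + p / 2) *
        ∫ g in Set.Ioi (0 : ℝ), gammaWeight q g *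
          (‖h‖ ^ 2 * P + σ ^ 2 / q * g) ^ (p / 2) := by
  have hL := lintegral_norm_rpow_add (h := h) hσ hq hs hw hsw hp
  have hm : AEStronglyMeasurable (fun ω => ‖h * s ω + w ω‖ ^ p) μ := by
    have h1 := hs.aemeasurable
    have h2 := hw.aemeasurable
    exact AEMeasurable.aestronglyMeasurable (by fun_prop)
  have hI := (integrableOn_gammaWeight_mul_rpow (A := ‖h‖ ^ 2 * P) (c := σ ^ 2 / q) (b := p / 2) hq
    (by positivity) (by positivity) (by positivity)).const_mul (Real.Gamma (1 + p / 2))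
  have hΓ := Real.Gamma_pos_of_pos (show 0 < 1 + p / 2 by positivity)
  have hnn : 0 ≤ᵐ[volume.restrict (Set.Ioi 0)] fun g => Real.Gamma (1 + p / 2) *
      (gammaWeight q g * (‖h‖ ^ 2 * P + σ ^ 2 / q * g) ^ (p / 2)) := by
    filter_upwards [self_mem_ae_restrict measurableSet_Ioi] with g hg
    have hg : 0 < g := hg
    have := gammaWeight_nonneg hq hg
    simp only [Pi.zero_apply]
    positivity
  have hL' : ∫⁻ ω, ENNReal.ofReal (‖h * s ω + w ω‖ ^ p) ∂μ =
      ENNReal.ofReal (∫ g in Set.Ioi (0 : ℝ), Real.Gamma (1 + p / 2) *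
        (gammaWeight q g * (‖h‖ ^ 2 * P + σ ^ 2 / q * g) ^ (p / 2))) := by
    rw [hL, ofReal_integral_eq_lintegral_ofReal hI hnn]
    refine lintegral_congr fun g => ?_
    rw [show σ ^ 2 * g / q = σ ^ 2 / q * g by ring]
    congr 1
    ring
  have hnn' : 0 ≤ᵐ[μ] fun ω => ‖h * s ω + w ω‖ ^ p := .of_forall fun ω => by positivity
  refine ⟨⟨hm, ?_⟩, ?_⟩
  · rw [hasFiniteIntegral_iff_ofReal hnn', hL']
    exact ENNReal.ofReal_lt_top
  · rw [integral_eq_lintegral_of_nonneg_ae hnn' hm, hL', ENNReal.toReal_ofReal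
      (integral_nonneg_of_ae hnn), integral_const_mul]

theorem integral_gammaWeight_mul_pow {q : ℝ} (hq : 0 < q) (k : ℕ) :
    ∫ g in Set.Ioi (0 : ℝ), gammaWeight q g * g ^ k = Real.Gamma (k + q) / Real.Gamma q := by
  have hΓ := Real.Gamma_pos_of_pos hq
  rw [Real.Gamma_eq_integral (show 0 < k + q by positivity), ← integral_div]
  refine setIntegral_congr_fun measurableSet_Ioi fun g hg => ?_
  have hg : 0 < g := hg
  simp only [gammaWeight]
  rw [show (k : ℝ) + q - 1 = q - 1 + k by ring, Real.rpow_add hg, Real.rpow_natCast]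
  ring

theorem integrableOn_gammaWeight_mul_pow {q : ℝ} (hq : 0 < q) (k : ℕ) :
    IntegrableOn (fun g => gammaWeight q g * g ^ k) (Set.Ioi 0) := by
  simpa using integrableOn_gammaWeight_mul_rpow (A := 0) (c := 1) (b := k) hq le_rfl zero_le_one
    (Nat.cast_nonneg k)

theorem even_moment_norm_add {h : ℂ} {P : ℝ≥0} {σ q : ℝ} (hσ : 0 < σ) (hq : 0 < q)
    {s w : Ω → ℂ} (hs : HasLaw s (complexGaussian P) μ) (hw : HasLaw w (mcLeish σ q) μ)
    (hsw : IndepFun s w μ) {m : ℕ} (hm : 1 ≤ m) :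
    Integrable (fun ω => ‖h * s ω + w ω‖ ^ (2 * m)) μ ∧
      ∫ ω, ‖h * s ω + w ω‖ ^ (2 * m) ∂μ =
        Real.Gamma (1 + m) / Real.Gamma q *
          ∑ k ∈ Finset.range (m + 1), (m.choose k : ℝ) * (‖h‖ ^ 2 * P) ^ (m - k) * σ ^ (2 * k) *
            Real.Gamma (k + q) * (q ^ k)⁻¹ := by
  have hm0 : (0 : ℝ) < 2 * m := by positivity
  have key := moment_norm_add (h := h) hσ hq hs hw hsw hm0
  have hcast : ∀ x : ℝ, x ^ (2 * m : ℝ) = x ^ (2 * m) := fun x => by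
    rw [← Real.rpow_natCast]; push_cast; rfl
  simp_rw [hcast] at key
  refine ⟨key.1, ?_⟩
  rw [key.2, show (2 * m : ℝ) / 2 = m by ring]
  have hexp : ∀ g : ℝ, gammaWeight q g * (‖h‖ ^ 2 * P + σ ^ 2 / q * g) ^ (m : ℝ) =
      ∑ k ∈ Finset.range (m + 1), ((m.choose k : ℝ) * (‖h‖ ^ 2 * P) ^ (m - k) * σ ^ (2 * k) *
        (q ^ k)⁻¹) * (gammaWeight q g * g ^ k) := fun g => by
    -- The summands are swapped so that `k` becomes the exponent of `g`.
    rw [Real.rpow_natCast, add_comm, add_pow, Finset.mul_sum]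
    refine Finset.sum_congr rfl fun k _ => ?_
    rw [mul_pow, div_pow, pow_mul]
    ring
  simp_rw [hexp]
  rw [integral_finsetSum _ fun k _ => (integrableOn_gammaWeight_mul_pow hq k).const_mul _,
    Finset.mul_sum, Finset.mul_sum]
  refine Finset.sum_congr rfl fun k _ => ?_
  rw [integral_const_mul, integral_gammaWeight_mul_pow hq]
  ring

end Moments

/-! ### Mellin transforms -/

theorem HasMellin.congr {f g : ℝ → ℂ} {z m : ℂ} (hf : HasMellin f z m)
    (h : ∀ t, 0 < t → f t = g t) : HasMellin g z m := by
  refine ⟨(integrableOn_congr_fun (fun t ht => ?_) measurableSet_Ioi).1 hf.1, ?_⟩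
  · rw [h t ht]
  · rw [← hf.2]
    refine setIntegral_congr_fun measurableSet_Ioi fun t ht => ?_
    simp only [h t ht]

/-- The Mellin transform turns the multiplicative convolution `x ↦ ∫ k(t) φ(x t) dt` into a
product. -/
theorem HasMellin.integral_mul_comp_mul {φ k : ℝ → ℂ} {z m : ℂ} (hφ : HasMellin φ z m)
    (hφm : Measurable φ) (hkm : Measurable k)
    (hk : IntegrableOn (fun t : ℝ => (t : ℂ) ^ (-z) * k t) (Set.Ioi 0)) :
    HasMellin (fun x => ∫ t in Set.Ioi (0 : ℝ), k t * φ (x * t)) z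
      ((∫ t in Set.Ioi (0 : ℝ), (t : ℂ) ^ (-z) * k t) * m) := by
  set F : ℝ → ℝ → ℂ := fun x t => (x : ℂ) ^ (z - 1) * (k t * φ (x * t)) with hF
  have hFm : Measurable (Function.uncurry F) := by
    simp only [hF, Function.uncurry_def]
    fun_prop
  have hsec : ∀ t, 0 < t → MellinConvergent (fun x => k t * φ (x * t)) z := fun t ht => by
    have h1 : MellinConvergent (fun x => φ (t * x)) z := (MellinConvergent.comp_mul_left ht).2 hφ.1
    simpa only [smul_eq_mul, mul_comm t] using h1.const_smul (k t)
  set G : ℝ → ℝ := fun y => ‖(y : ℂ) ^ (z - 1) * φ y‖ with hG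
  -- Scaling `y = x t` separates the variables in the norm integral, which reduces Fubini's
  -- hypothesis to `hk` and the convergence of the transform of `φ`.
  have hnorm : ∀ t, 0 < t → ∫ x in Set.Ioi (0 : ℝ), ‖F x t‖ =
      ‖(t : ℂ) ^ (-z) * k t‖ * ∫ y in Set.Ioi (0 : ℝ), G y := fun t ht => by
    have h1 := integral_comp_mul_right_Ioi G 0 ht
    rw [zero_mul] at h1
    have h2 : ∫ y in Set.Ioi (0 : ℝ), G y = t * ∫ x in Set.Ioi (0 : ℝ), G (x * t) := by
      rw [h1, smul_eq_mul]; field_simp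
    rw [h2, ← mul_assoc, ← integral_const_mul]
    refine setIntegral_congr_fun measurableSet_Ioi fun x hx => ?_
    have hx : 0 < x := hx
    simp only [hF, hG, norm_mul]
    rw [Complex.norm_cpow_eq_rpow_re_of_pos hx, Complex.norm_cpow_eq_rpow_re_of_pos ht,
      Complex.norm_cpow_eq_rpow_re_of_pos (mul_pos hx ht), Real.mul_rpow hx.le ht.le]
    have h3 : t ^ (-z).re * t * t ^ (z - 1).re = 1 := by
      rw [← Real.rpow_add_one ht.ne', ← Real.rpow_add ht]
      simp
    linear_combination (-(‖k t‖ * x ^ (z - 1).re * ‖φ (x * t)‖)) * h3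
  have hint : Integrable (Function.uncurry F)
      ((volume.restrict (Set.Ioi 0)).prod (volume.restrict (Set.Ioi 0))) := by
    rw [integrable_prod_iff' hFm.aestronglyMeasurable]
    constructor
    · filter_upwards [self_mem_ae_restrict measurableSet_Ioi] with t ht
      exact hsec t ht
    · refine (hk.norm.mul_const (∫ y in Set.Ioi (0 : ℝ), G y)).congr ?_
      filter_upwards [self_mem_ae_restrict measurableSet_Ioi] with t ht
      exact (hnorm t ht).symm
  have hpull : ∀ x : ℝ, ∫ t in Set.Ioi (0 : ℝ), F x t =
      (x : ℂ) ^ (z - 1) • ∫ t in Set.Ioi (0 : ℝ), k t * φ (x * t) := fun x => by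
    rw [smul_eq_mul, ← integral_const_mul]
  refine ⟨?_, ?_⟩
  · have := hint.integral_prod_left
    simp only [Function.uncurry_apply_pair, hpull] at this
    exact this
  · rw [mellin]
    simp_rw [← hpull]
    rw [integral_integral_swap hint, ← integral_mul_const]
    refine setIntegral_congr_fun measurableSet_Ioi fun t ht => ?_
    have h1 : mellin (fun x => φ (x * t)) z = (t : ℂ) ^ (-z) • mellin φ z :=
      mellin_comp_mul_right φ z ht
    rw [hφ.2, mellin] at h1
    simp only [hF, smul_eq_mul] at h1 ⊢
    rw [mul_right_comm, ← h1, ← integral_mul_const]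
    congr 1
    ext x
    ring

theorem hasMellin_exp_neg {z : ℂ} (hz : 0 < z.re) :
    HasMellin (fun y : ℝ => (Real.exp (-y) : ℂ)) z (Complex.Gamma z) := by
  refine ⟨?_, ?_⟩
  · simpa only [MellinConvergent, smul_eq_mul, mul_comm] using Complex.GammaIntegral_convergent hz
  · rw [Complex.Gamma_eq_integral hz, Complex.GammaIntegral_eq_mellin]

theorem integral_cpow_mul_rpow_mul_exp_neg {q : ℝ} {s : ℂ} (hs : 0 < (q + s).re) :
    IntegrableOn (fun t : ℝ => (t : ℂ) ^ s * ((t ^ (q - 1) * Real.exp (-t) : ℝ) : ℂ))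
      (Set.Ioi 0) ∧
    ∫ t in Set.Ioi (0 : ℝ), (t : ℂ) ^ s * ((t ^ (q - 1) * Real.exp (-t) : ℝ) : ℂ) =
      Complex.Gamma (q + s) := by
  have hE : Set.EqOn (fun t : ℝ => (Real.exp (-t) : ℂ) * (t : ℂ) ^ ((q : ℂ) + s - 1))
      (fun t : ℝ => (t : ℂ) ^ s * ((t ^ (q - 1) * Real.exp (-t) : ℝ) : ℂ)) (Set.Ioi 0) := by
    intro t ht
    have ht : 0 < t := ht
    simp only
    rw [Complex.ofReal_mul, Complex.ofReal_cpow ht.le,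
      show (q : ℂ) + s - 1 = s + (q - 1 : ℝ) by push_cast; ring,
      Complex.cpow_add _ _ (by exact_mod_cast ht.ne')]
    ring
  refine ⟨(integrableOn_congr_fun hE measurableSet_Ioi).1 (Complex.GammaIntegral_convergent hs),
    ?_⟩
  rw [Complex.Gamma_eq_integral hs, Complex.GammaIntegral]
  exact (setIntegral_congr_fun measurableSet_Ioi hE).symm

/-- `Γ(a) (1 + y)^(-a)` is the integral of `t^(a-1) exp(-t) exp(-y t)`, a multiplicative convolution
of two functions whose transforms are Gamma functions. -/
theorem hasMellin_one_add_rpow_neg {a : ℝ} {z : ℂ} (hz : 0 < z.re) (hza : z.re < a) :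
    HasMellin (fun y : ℝ => (((1 + y) ^ (-a) : ℝ) : ℂ)) z
      (Complex.Gamma (a - z) * Complex.Gamma z / Complex.Gamma a) := by
  have ha : 0 < a := hz.trans hza
  have h1 := integral_cpow_mul_rpow_mul_exp_neg (q := a) (s := -z) (by simpa using hza)
  have h2 := (hasMellin_exp_neg hz).integral_mul_comp_mul (by fun_prop) (by fun_prop) h1.1
  rw [h1.2, ← sub_eq_add_neg] at h2
  have h3 := (hasMellin_const_smul h2.1 (Complex.Gamma a)⁻¹)
  rw [h2.2] at h3
  rw [div_eq_inv_mul]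
  refine h3.congr fun y hy => ?_
  have h4 := Real.integral_rpow_mul_exp_neg_mul_Ioi ha (show 0 < 1 + y by linarith)
  have hΓ := (Real.Gamma_pos_of_pos ha).ne'
  have h5 : (((1 + y) ^ (-a) : ℝ) : ℂ) = (Complex.Gamma a)⁻¹ *
      ((∫ t in Set.Ioi (0 : ℝ), t ^ (a - 1) * Real.exp (-((1 + y) * t)) : ℝ) : ℂ) := by
    rw [h4, Complex.Gamma_ofReal, ← Complex.ofReal_inv, ← Complex.ofReal_mul]
    congr 1
    rw [one_div, Real.inv_rpow (by linarith), Real.rpow_neg (by linarith)]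
    field_simp
  rw [h5, ← integral_complex_ofReal, smul_eq_mul]
  congr 2
  ext t
  rw [← Complex.ofReal_mul, mul_assoc, ← Real.exp_add]
  congr 4
  ring

/-! ### Taylor's formula for real powers -/

/-- The generalized binomial coefficient `b (b - 1) ⋯ (b - n + 1) / n!`. -/
noncomputable def realChoose (b : ℝ) (n : ℕ) : ℝ := (∏ j ∈ Finset.range n, (b - j)) / n.factorial

theorem realChoose_succ (b : ℝ) (n : ℕ) :
    realChoose b (n + 1) * (n + 1) = realChoose b n * (b - n) := by
  rw [realChoose, realChoose, Finset.prod_range_succ, Nat.factorial_succ]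
  push_cast
  field_simp

theorem hasDerivAt_one_add_mul_rpow {y t : ℝ} (β : ℝ) (h : 0 < 1 + t * y) :
    HasDerivAt (fun t => (1 + t * y) ^ β) (β * y * (1 + t * y) ^ (β - 1)) t := by
  have h1 : HasDerivAt (fun t : ℝ => 1 + t * y) y t := by
    simpa using ((hasDerivAt_id t).mul_const y).const_add 1
  convert h1.rpow_const (p := β) (Or.inl h.ne') using 1
  ring

theorem one_add_mul_pos {y t : ℝ} (hy : 0 ≤ y) (ht : t ∈ Set.uIcc (0 : ℝ) 1) : 0 < 1 + t * y := by
  rw [Set.uIcc_of_le zero_le_one] at ht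
  nlinarith [ht.1]

theorem continuousOn_one_add_mul_rpow {y : ℝ} (hy : 0 ≤ y) (β : ℝ) :
    ContinuousOn (fun t => (1 + t * y) ^ β) (Set.uIcc 0 1) := fun _ ht =>
  (hasDerivAt_one_add_mul_rpow β (one_add_mul_pos hy ht)).continuousAt.continuousWithinAt

/-- Induction on `N`, integrating the remainder by parts. -/
theorem one_add_rpow_sub_sum {y : ℝ} (hy : 0 ≤ y) (b : ℝ) (N : ℕ) :
    (1 + y) ^ b - ∑ l ∈ Finset.range (N + 1), realChoose b l * y ^ l =
      (N + 1) * realChoose b (N + 1) * y ^ (N + 1) *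
        ∫ t in (0 : ℝ)..1, (1 - t) ^ N * (1 + t * y) ^ (b - N - 1) := by
  induction N with
  | zero =>
    have h := intervalIntegral.integral_eq_sub_of_hasDerivAt
      (fun t ht => hasDerivAt_one_add_mul_rpow b (one_add_mul_pos hy ht))
      (((continuousOn_one_add_mul_rpow hy _).const_mul _).intervalIntegrable)
    rw [intervalIntegral.integral_const_mul] at h
    simp only [realChoose]
    simp at h ⊢
    linarith
  | succ N ih =>
    -- This primitive vanishes at `t = 1`; the boundary term at `t = 0` yields the next Taylor term.
    have hd : ∀ t : ℝ, HasDerivAt (fun t : ℝ => -((1 - t) ^ (N + 1) / (N + 1))) ((1 - t) ^ N) t := by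
      intro t
      have h1 : HasDerivAt (fun t : ℝ => 1 - t) (-1) t := by
        simpa using (hasDerivAt_id t).const_sub 1
      refine ((h1.pow (N + 1)).div_const ((N : ℝ) + 1)).neg.congr_deriv ?_
      have : (N : ℝ) + 1 ≠ 0 := by positivity
      push_cast
      field_simp
    have h := intervalIntegral.integral_mul_deriv_eq_deriv_mul
      (fun t ht => hasDerivAt_one_add_mul_rpow (b - N - 1) (one_add_mul_pos hy ht))
      (fun t _ => hd t)
      (((continuousOn_one_add_mul_rpow hy _).const_mul _).intervalIntegrable)
      ((by fun_prop : Continuous fun t : ℝ => (1 - t) ^ N).intervalIntegrable 0 1)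
    have hN : (N : ℝ) + 1 ≠ 0 := by positivity
    have h2 : ∫ t in (0 : ℝ)..1, (b - N - 1) * y * (1 + t * y) ^ (b - N - 1 - 1) *
        -((1 - t) ^ (N + 1) / (N + 1)) = -((b - N - 1) * y / (N + 1)) *
        ∫ t in (0 : ℝ)..1, (1 - t) ^ (N + 1) * (1 + t * y) ^ (b - N - 1 - 1) := by
      rw [← intervalIntegral.integral_const_mul]
      congr 1
      ext t
      ring
    rw [h2] at h
    simp only [mul_comm ((1 + _ * y) ^ (b - (N : ℝ) - 1))] at h
    rw [Finset.sum_range_succ, ← sub_sub, ih, h]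
    have h3 := realChoose_succ b (N + 1)
    push_cast at h3 ⊢
    rw [show b - ((N : ℝ) + 1) - 1 = b - N - 1 - 1 by ring]
    set J := ∫ t in (0 : ℝ)..1, (1 - t) ^ (N + 1) * (1 + t * y) ^ (b - N - 1 - 1)
    simp
    have h4 : (↑N + 1) * realChoose b (N + 1) * y ^ (N + 1) *
        (((N : ℝ) + 1)⁻¹ + (b - ↑N - 1) * y / (↑N + 1) * J) = realChoose b (N + 1) * y ^ (N + 1) +
        realChoose b (N + 1) * y ^ (N + 1) * ((b - ↑N - 1) * y) * J := by
      field_simp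
    rw [h4]
    linear_combination (-y ^ (N + 2) * J) * h3

theorem Complex.Gamma_add_natCast {z : ℂ} (hz : ∀ k : ℕ, z ≠ -k) (n : ℕ) :
    Complex.Gamma (z + n) = (∏ j ∈ Finset.range n, (z + j)) * Complex.Gamma z := by
  induction n with
  | zero => simp
  | succ n ih =>
    rw [Nat.cast_succ, ← add_assoc, Complex.Gamma_add_one _ fun h => hz n (eq_neg_of_add_eq_zero_left h),
      ih, Finset.prod_range_succ]
    ring

theorem prod_range_sub_natCast (u : ℂ) (n : ℕ) :
    ∏ j ∈ Finset.range n, (u - j) = (-1) ^ n * ∏ j ∈ Finset.range n, (-u + j) := by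
  induction n with
  | zero => simp
  | succ n ih =>
    rw [Finset.prod_range_succ, ih, Finset.prod_range_succ]
    ring

theorem ne_neg_natCast_of_lt {N : ℕ} {s : ℂ} (h1 : N < s.re) (h2 : s.re < N + 1) (k : ℕ) :
    -s ≠ -k := by
  intro h
  have h3 : s = k := neg_injective h
  rw [h3, Complex.natCast_re] at h1 h2
  have h1' : N < k := by exact_mod_cast h1
  have h2' : k < N + 1 := by exact_mod_cast h2
  omega

/-- The remainder of the Taylor expansion of `(1 + y) ^ b` at `y = 0`, to the order `N`. -/
noncomputable def rpowRemainder (b : ℝ) (N : ℕ) (y : ℝ) : ℝ :=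
  (1 + y) ^ b - ∑ l ∈ Finset.range (N + 1), realChoose b l * y ^ l

theorem measurable_rpowRemainder (b : ℝ) (N : ℕ) : Measurable (rpowRemainder b N) := by
  unfold rpowRemainder; fun_prop

/-- Euler's Beta integral, put on the half-line by an indicator so that it can serve as a kernel in
`HasMellin.integral_mul_comp_mul`. -/
theorem integral_cpow_mul_one_sub_pow {u : ℂ} (hu : 0 < u.re) (N : ℕ) :
    IntegrableOn (fun t : ℝ => (t : ℂ) ^ (u - 1) *
      (Set.Iic (1 : ℝ)).indicator (fun t : ℝ => (((1 - t) ^ N : ℝ) : ℂ)) t) (Set.Ioi 0) ∧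
    ∫ t in Set.Ioi (0 : ℝ), (t : ℂ) ^ (u - 1) *
      (Set.Iic (1 : ℝ)).indicator (fun t : ℝ => (((1 - t) ^ N : ℝ) : ℂ)) t =
        Complex.betaIntegral u (N + 1) := by
  have hE : ∀ t : ℝ, (t : ℂ) ^ (u - 1) *
      (Set.Iic (1 : ℝ)).indicator (fun t : ℝ => (((1 - t) ^ N : ℝ) : ℂ)) t =
      (Set.Iic (1 : ℝ)).indicator
        (fun t : ℝ => (t : ℂ) ^ (u - 1) * (1 - (t : ℂ)) ^ ((N + 1 : ℂ) - 1)) t := fun t => by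
    by_cases ht : t ∈ Set.Iic (1 : ℝ)
    · simp [ht]
    · simp [ht]
  have hI : Set.Iic (1 : ℝ) ∩ Set.Ioi 0 = Set.Ioc 0 1 := by
    rw [Set.inter_comm, Set.Ioi_inter_Iic]
  simp_rw [hE]
  refine ⟨?_, ?_⟩
  · rw [IntegrableOn, integrable_indicator_iff measurableSet_Iic, IntegrableOn,
      Measure.restrict_restrict measurableSet_Iic, hI]
    have := Complex.betaIntegral_convergent hu (show 0 < ((N : ℂ) + 1).re by simp; positivity)
    rwa [intervalIntegrable_iff_integrableOn_Ioc_of_le zero_le_one] at this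
  · rw [integral_indicator measurableSet_Iic, Measure.restrict_restrict measurableSet_Iic, hI,
      Complex.betaIntegral, intervalIntegral.integral_of_le zero_le_one]

/-- The integral remainder is `y^(N+1)` times a multiplicative convolution of `(1 - t)^N` on `[0,
1]` with `(1 + y)^(b-N-1)`. The Beta factor needs `Re s > N`, the power needs `b < Re s < N + 1`.
The recurrence of `Γ` then removes `N` from the value. -/
theorem hasMellin_rpowRemainder {b : ℝ} (hb : ∀ k : ℕ, b ≠ k) {N : ℕ} {s : ℂ} (hNs : N < s.re)
    (hsN : s.re < N + 1) (hbs : b < s.re) :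
    HasMellin (fun y : ℝ => (rpowRemainder b N y : ℂ)) (-s)
      (Complex.Gamma (-s) * Complex.Gamma (s - b) / Complex.Gamma (-b)) := by
  have hz : 0 < ((N : ℂ) + 1 - s).re := by simp; linarith
  have hza : ((N : ℂ) + 1 - s).re < N + 1 - b := by simp; linarith
  have h1 := hasMellin_one_add_rpow_neg hz hza
  have hbeta := integral_cpow_mul_one_sub_pow (u := s - N) (by simpa using hNs) N
  rw [show s - (N : ℂ) - 1 = -((N : ℂ) + 1 - s) by ring] at hbeta
  have h2 := h1.integral_mul_comp_mul (by fun_prop)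
    ((show Measurable fun t : ℝ => (((1 - t) ^ N : ℝ) : ℂ) by fun_prop).indicator
      measurableSet_Iic) hbeta.1
  rw [hbeta.2, Complex.betaIntegral_eval_nat_add_one_right (by simpa using hNs)] at h2
  have h3 : HasMellin (fun y : ℝ => (y : ℂ) ^ ((N : ℂ) + 1) •
      ∫ t in Set.Ioi (0 : ℝ), (Set.Iic (1 : ℝ)).indicator (fun t : ℝ => (((1 - t) ^ N : ℝ) : ℂ)) t *
        (((1 + y * t) ^ (-((N : ℝ) + 1 - b)) : ℝ) : ℂ)) (-s) _ :=
    ⟨MellinConvergent.cpow_smul.2 (by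
      rw [show -s + ((N : ℂ) + 1) = (N : ℂ) + 1 - s by ring]; exact h2.1), by
      rw [mellin_cpow_smul, show -s + ((N : ℂ) + 1) = (N : ℂ) + 1 - s by ring]⟩
  have h4 := hasMellin_const_smul h3.1 (((N : ℂ) + 1) * realChoose b (N + 1))
  rw [h3.2, h2.2] at h4
  have hval : (((N : ℂ) + 1) * realChoose b (N + 1)) •
      ((N.factorial / ∏ j ∈ Finset.range (N + 1), (s - (N : ℂ) + j)) *
        (Complex.Gamma (((N : ℝ) + 1 - b : ℝ) - ((N : ℂ) + 1 - s)) * Complex.Gamma ((N : ℂ) + 1 - s) /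
          Complex.Gamma ((N : ℝ) + 1 - b : ℝ))) =
      Complex.Gamma (-s) * Complex.Gamma (s - b) / Complex.Gamma (-b) := by
    have hbn : ∀ k : ℕ, -(b : ℂ) ≠ -k := fun k h => hb k (by exact_mod_cast neg_injective h)
    have e1 := Complex.Gamma_add_natCast (ne_neg_natCast_of_lt hNs hsN) (N + 1)
    have e2 := Complex.Gamma_add_natCast hbn (N + 1)
    have e3 : ∏ j ∈ Finset.range (N + 1), (s - (N : ℂ) + j) =
        (-1) ^ (N + 1) * ∏ j ∈ Finset.range (N + 1), (-s + j) := by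
      rw [← prod_range_sub_natCast, ← Finset.prod_range_reflect]
      refine Finset.prod_congr rfl fun j hj => ?_
      have hj : j ≤ N := Nat.lt_succ_iff.1 (Finset.mem_range.1 hj)
      rw [show N + 1 - 1 - j = N - j by omega, Nat.cast_sub hj]
      ring
    have e4 : ((N : ℂ) + 1) * realChoose b (N + 1) =
        (-1) ^ (N + 1) * (∏ j ∈ Finset.range (N + 1), (-(b : ℂ) + j)) / N.factorial := by
      rw [← prod_range_sub_natCast, realChoose, Nat.factorial_succ]
      push_cast
      have h5 : (N : ℂ) + 1 ≠ 0 := by exact_mod_cast N.succ_ne_zero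
      have h6 : (N.factorial : ℂ) ≠ 0 := by exact_mod_cast N.factorial_ne_zero
      field_simp
    have n1 : ∏ j ∈ Finset.range (N + 1), (-s + (j : ℂ)) ≠ 0 :=
      Finset.prod_ne_zero_iff.2 fun j _ h =>
        ne_neg_natCast_of_lt hNs hsN j (eq_neg_of_add_eq_zero_left h)
    have n2 : ∏ j ∈ Finset.range (N + 1), (-(b : ℂ) + (j : ℂ)) ≠ 0 :=
      Finset.prod_ne_zero_iff.2 fun j _ h => hbn j (eq_neg_of_add_eq_zero_left h)
    have n3 : Complex.Gamma (-b) ≠ 0 := Complex.Gamma_ne_zero hbn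
    have n4 : (N.factorial : ℂ) ≠ 0 := by exact_mod_cast N.factorial_ne_zero
    rw [e3, smul_eq_mul, e4,
      show ((N : ℂ) + 1 - s) = -s + ((N + 1 : ℕ) : ℂ) by push_cast; ring, e1,
      show (((N : ℝ) + 1 - b : ℝ) : ℂ) = -(b : ℂ) + ((N + 1 : ℕ) : ℂ) by push_cast; ring, e2,
      show -(b : ℂ) + ((N + 1 : ℕ) : ℂ) - (-s + ((N + 1 : ℕ) : ℂ)) = s - b by ring]
    have n5 : ((-1 : ℂ)) ^ (N + 1) ≠ 0 := by simp
    field_simp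
  rw [hval] at h4
  refine h4.congr fun y hy => ?_
  rw [rpowRemainder, one_add_rpow_sub_sum hy.le, intervalIntegral.integral_of_le zero_le_one]
  have h5 : ∀ t : ℝ, (Set.Iic (1 : ℝ)).indicator (fun t : ℝ => (((1 - t) ^ N : ℝ) : ℂ)) t *
        (((1 + y * t) ^ (-((N : ℝ) + 1 - b)) : ℝ) : ℂ) = (Set.Iic (1 : ℝ)).indicator
        (fun t : ℝ => (((1 - t) ^ N * (1 + t * y) ^ (b - N - 1) : ℝ) : ℂ)) t := fun t => by
    by_cases ht : t ∈ Set.Iic (1 : ℝ)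
    · rw [Set.indicator_of_mem ht, Set.indicator_of_mem ht, ← Complex.ofReal_mul, mul_comm y,
        show -((N : ℝ) + 1 - b) = b - N - 1 by ring]
    · rw [Set.indicator_of_notMem ht, Set.indicator_of_notMem ht, zero_mul]
  simp_rw [h5]
  rw [integral_indicator measurableSet_Iic, Measure.restrict_restrict measurableSet_Iic,
    Set.inter_comm, Set.Ioi_inter_Iic, integral_complex_ofReal, smul_eq_mul, smul_eq_mul,
    show (N : ℂ) + 1 = ((N + 1 : ℕ) : ℂ) by push_cast; rfl, Complex.cpow_natCast]
  push_cast
  ring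

/-! ### The Gamma average of the Taylor remainder -/

/-- The Gamma average of the Taylor remainder of `(1 + x g) ^ b`. -/
noncomputable def gammaRemainder (q b : ℝ) (N : ℕ) (x : ℝ) : ℝ :=
  ∫ g in Set.Ioi (0 : ℝ), gammaWeight q g * rpowRemainder b N (x * g)

theorem hasMellin_gammaRemainder {q b : ℝ} (hq : 0 < q) (hb : ∀ k : ℕ, b ≠ k) {N : ℕ} {s : ℂ}
    (hNs : N < s.re) (hsN : s.re < N + 1) (hbs : b < s.re) :
    HasMellin (fun x : ℝ => (gammaRemainder q b N x : ℂ)) (-s)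
      (Complex.Gamma (q + s) / Complex.Gamma q *
        (Complex.Gamma (-s) * Complex.Gamma (s - b) / Complex.Gamma (-b))) := by
  have hqs : 0 < ((q : ℂ) + s).re := by
    simp only [Complex.add_re, Complex.ofReal_re]
    have := N.cast_nonneg (α := ℝ)
    linarith
  have h1 := integral_cpow_mul_rpow_mul_exp_neg hqs
  have hE : ∀ t : ℝ, (t : ℂ) ^ (- -s) * (gammaWeight q t : ℂ) =
      (t : ℂ) ^ s * ((t ^ (q - 1) * Real.exp (-t) : ℝ) : ℂ) / Complex.Gamma q := fun t => by
    rw [gammaWeight, neg_neg, Complex.Gamma_ofReal]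
    push_cast
    ring
  have hm1 := measurable_gammaWeight q
  have hm2 := measurable_rpowRemainder b N
  have h2 := (hasMellin_rpowRemainder hb hNs hsN hbs).integral_mul_comp_mul (by fun_prop)
    (k := fun t => (gammaWeight q t : ℂ)) (by fun_prop) (by
      simp_rw [hE]; exact h1.1.div_const _)
  simp_rw [hE] at h2
  rw [integral_div, h1.2] at h2
  refine h2.congr fun x _ => ?_
  rw [gammaRemainder, ← integral_complex_ofReal]
  simp

/-- The subtracted terms are the ones that the circles of the contour restore. -/
theorem gammaRemainder_eq {q b x : ℝ} (hq : 0 < q) (hb : 0 ≤ b) (hx : 0 ≤ x) (N : ℕ) :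
    gammaRemainder q b N x = (∫ g in Set.Ioi (0 : ℝ), gammaWeight q g * (1 + x * g) ^ b) -
      ∑ l ∈ Finset.range (N + 1), realChoose b l * x ^ l *
        (Real.Gamma (l + q) / Real.Gamma q) := by
  have h1 : ∀ g, gammaWeight q g * rpowRemainder b N (x * g) =
      gammaWeight q g * (1 + x * g) ^ b -
        ∑ l ∈ Finset.range (N + 1), realChoose b l * x ^ l * (gammaWeight q g * g ^ l) := fun g => by
    rw [rpowRemainder, mul_sub, Finset.mul_sum]
    congr 1
    refine Finset.sum_congr rfl fun l _ => ?_
    rw [mul_pow]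
    ring
  have hi : ∀ l ∈ Finset.range (N + 1), IntegrableOn
      (fun g => realChoose b l * x ^ l * (gammaWeight q g * g ^ l)) (Set.Ioi 0) := fun l _ =>
    (integrableOn_gammaWeight_mul_pow hq l).const_mul _
  simp_rw [gammaRemainder, h1]
  rw [integral_sub (integrableOn_gammaWeight_mul_rpow hq zero_le_one hx hb)
    (integrable_finsetSum _ hi), integral_finsetSum _ hi]
  simp_rw [integral_const_mul, integral_gammaWeight_mul_pow hq]

/-- Needed for pointwise Mellin inversion. Near `x` the integrand is dominated by its value at `x +
1`. -/
theorem continuousAt_gammaRemainder {q b x : ℝ} (hq : 0 < q) (hb : 0 ≤ b) (hx : 0 < x) (N : ℕ) :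
    ContinuousAt (gammaRemainder q b N) x := by
  have hE : gammaRemainder q b N =ᶠ[nhds x] fun x =>
      (∫ g in Set.Ioi (0 : ℝ), gammaWeight q g * (1 + x * g) ^ b) -
      ∑ l ∈ Finset.range (N + 1), realChoose b l * x ^ l *
        (Real.Gamma (l + q) / Real.Gamma q) := by
    filter_upwards [lt_mem_nhds hx] with y hy
    exact gammaRemainder_eq hq hb (le_of_lt hy) N
  refine ContinuousAt.congr ?_ hE.symm
  refine ContinuousAt.sub ?_ (by fun_prop)
  have hm := measurable_gammaWeight q
  refine continuousAt_of_dominated (bound := fun g => gammaWeight q g * (1 + (x + 1) * g) ^ b)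
    (.of_forall fun y => by fun_prop) ?_
    (integrableOn_gammaWeight_mul_rpow hq zero_le_one (by positivity) hb) ?_
  · filter_upwards [lt_mem_nhds hx, gt_mem_nhds (lt_add_one x)] with y hy0 hy1
    filter_upwards [self_mem_ae_restrict measurableSet_Ioi] with g hg
    have hg : 0 < g := hg
    have hw := gammaWeight_nonneg hq hg
    rw [Real.norm_of_nonneg (by positivity)]
    gcongr
  · filter_upwards [self_mem_ae_restrict measurableSet_Ioi] with g hg
    have hg : 0 < g := hg
    have : (1 : ℝ) + x * g ≠ 0 := by positivity
    fun_prop (disch := first | assumption | exact Or.inl this)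

/-! ### The Mellin-Barnes integral along a vertical line -/

theorem norm_Gamma_le {z : ℂ} (hz : 0 < z.re) : ‖Complex.Gamma z‖ ≤ Real.Gamma z.re := by
  rw [Complex.Gamma_eq_integral hz, Complex.GammaIntegral, Real.Gamma_eq_integral hz]
  refine (norm_integral_le_integral_norm _).trans_eq ?_
  refine setIntegral_congr_fun measurableSet_Ioi fun x hx => ?_
  have hx : 0 < x := hx
  simp only [norm_mul, Complex.norm_real, Complex.norm_cpow_eq_rpow_re_of_pos hx]
  rw [Real.norm_of_nonneg (Real.exp_pos _).le]
  simp

/-- The product of Gamma functions in the Mellin-Barnes integral. -/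
noncomputable def barnesKernel (q b : ℝ) (s : ℂ) : ℂ :=
  Complex.Gamma (-s) * (Complex.Gamma (q + s) * Complex.Gamma (s - b))

/-- Stirling's formula is avoided: `|Γ(z)| ≤ Γ(Re z)` bounds two factors, the first after a shift by
`N + 1` into the right half-plane, and writing `Γ(q + s)` as `Γ(q + s + 2)` over a quadratic gives
decay like `1 / (1 + y²)`. -/
theorem verticalIntegrable_barnesKernel {q b c : ℝ} (hq : 0 < q) {N : ℕ} (hNc : N < c)
    (hcN : c < N + 1) (hbc : b < c) : Complex.VerticalIntegrable (barnesKernel q b) c := by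
  have hc : 0 < c := N.cast_nonneg.trans_lt hNc
  have hcont : Continuous fun y : ℝ => barnesKernel q b (c + y * Complex.I) := by
    have hG : ∀ {f : ℝ → ℂ}, Continuous f → (∀ y, ∀ m : ℕ, f y ≠ -m) →
        Continuous fun y => Complex.Gamma (f y) := fun hf h =>
      continuous_iff_continuousAt.2 fun y =>
        ((Complex.differentiableAt_Gamma _ (h y)).continuousAt).comp hf.continuousAt
    refine (hG (by fun_prop) fun y m => ne_neg_natCast_of_lt (N := N) (by simpa) (by simpa) m).mul
      ((hG (by fun_prop) fun y m h => ?_).mul (hG (by fun_prop) fun y m h => ?_))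
    · have := congrArg Complex.re h
      simp at this
      have := m.cast_nonneg (α := ℝ)
      linarith
    · have := congrArg Complex.re h
      simp at this
      have := m.cast_nonneg (α := ℝ)
      linarith
  set D : ℝ := ∏ j ∈ Finset.range (N + 1), |(j : ℝ) - c| with hD
  have hDpos : 0 < D := Finset.prod_pos fun j _ => abs_pos.2 fun h => by
    have hj : c = j := by linarith
    rw [hj] at hNc hcN
    have h1 : N < j := by exact_mod_cast hNc
    have h2 : j < N + 1 := by exact_mod_cast hcN
    omega
  -- The constant `min 1 (c²)` comes from `|q + s + k|² ≥ c² + y² ≥ min 1 (c²) (1 + y²)`.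
  have hint : Integrable fun y : ℝ => Real.Gamma (N + 1 - c) / D *
      (Real.Gamma (q + c + 2) * ((min 1 (c ^ 2))⁻¹ * (1 + y ^ 2)⁻¹) * Real.Gamma (c - b)) :=
    (((integrable_inv_one_add_sq.const_mul _).const_mul _).mul_const _).const_mul _
  refine hint.mono' hcont.aestronglyMeasurable (.of_forall fun y => ?_)
  set s : ℂ := c + y * Complex.I with hs
  have hre : s.re = c := by simp [hs]
  have him : s.im = y := by simp [hs]
  have h1 : ‖Complex.Gamma (-s)‖ ≤ Real.Gamma (N + 1 - c) / D := by
    have e := Complex.Gamma_add_natCast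
      (ne_neg_natCast_of_lt (s := s) (N := N) (by rwa [hre]) (by rwa [hre])) (N + 1)
    have h2 := norm_Gamma_le (z := -s + ((N + 1 : ℕ) : ℂ)) (by simp [hre]; linarith)
    rw [e, norm_mul, norm_prod] at h2
    have h3 : D ≤ ∏ j ∈ Finset.range (N + 1), ‖-s + (j : ℂ)‖ := by
      refine Finset.prod_le_prod (fun _ _ => abs_nonneg _) fun j _ => ?_
      have := Complex.abs_re_le_norm (-s + (j : ℂ))
      simpa [hre, sub_eq_neg_add] using this
    rw [le_div_iff₀ hDpos, mul_comm]
    refine (mul_le_mul_of_nonneg_right h3 (norm_nonneg _)).trans (h2.trans_eq ?_)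
    simp [hre]
    ring_nf
  have h2 : ‖Complex.Gamma (q + s)‖ ≤
      Real.Gamma (q + c + 2) * ((min 1 (c ^ 2))⁻¹ * (1 + y ^ 2)⁻¹) := by
    have hne : ∀ k : ℕ, (q : ℂ) + s ≠ -k := fun k h => by
      have := congrArg Complex.re h
      simp [hre] at this
      have := k.cast_nonneg (α := ℝ)
      linarith
    have e := Complex.Gamma_add_natCast hne 2
    have h3 := norm_Gamma_le (z := q + s + ((2 : ℕ) : ℂ)) (by simp [hre]; positivity)
    rw [e, norm_mul, norm_prod, Finset.prod_range_succ, Finset.prod_range_one] at h3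
    have hm : 0 < min 1 (c ^ 2) := lt_min one_pos (by positivity)
    have hlow : ∀ k : ℕ, Real.sqrt (min 1 (c ^ 2) * (1 + y ^ 2)) ≤ ‖(q : ℂ) + s + (k : ℂ)‖ := by
      intro k
      refine Real.sqrt_le_iff.2 ⟨norm_nonneg _, ?_⟩
      rw [Complex.sq_norm, Complex.normSq_apply]
      simp only [Complex.add_re, Complex.add_im, Complex.ofReal_re, Complex.ofReal_im,
        Complex.natCast_re, Complex.natCast_im, hre, him]
      have hk := k.cast_nonneg (α := ℝ)
      have hy := sq_nonneg y
      have l1 := min_le_left 1 (c ^ 2)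
      have l2 := min_le_right 1 (c ^ 2)
      nlinarith [mul_le_mul_of_nonneg_right l1 hy, mul_nonneg hq.le hk, mul_pos hq hc,
        mul_nonneg hc.le hk, mul_pos hq hq, mul_nonneg hk hk]
    have hsq : min 1 (c ^ 2) * (1 + y ^ 2) ≤
        ‖(q : ℂ) + s + ((0 : ℕ) : ℂ)‖ * ‖(q : ℂ) + s + ((1 : ℕ) : ℂ)‖ := by
      rw [← Real.mul_self_sqrt (show 0 ≤ min 1 (c ^ 2) * (1 + y ^ 2) by positivity)]
      exact mul_le_mul (hlow 0) (hlow 1) (Real.sqrt_nonneg _) (norm_nonneg _)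
    rw [← mul_inv, ← div_eq_mul_inv, le_div_iff₀ (by positivity), mul_comm]
    refine (mul_le_mul_of_nonneg_right hsq (norm_nonneg _)).trans (h3.trans_eq ?_)
    simp [hre]
  have h3 : ‖Complex.Gamma (s - b)‖ ≤ Real.Gamma (c - b) := by
    simpa [hre] using norm_Gamma_le (z := s - b) (by simpa [hre] using hbc)
  have hΓ1 := Real.Gamma_pos_of_pos (show 0 < N + 1 - c by linarith)
  have hΓ2 := Real.Gamma_pos_of_pos (show 0 < q + c + 2 by positivity)
  rw [barnesKernel, norm_mul, norm_mul]
  have hm : 0 < min 1 (c ^ 2) := lt_min one_pos (by positivity)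
  gcongr

theorem integral_barnesKernel {q b c x : ℝ} (hq : 0 < q) (hb0 : 0 < b) (hb : ∀ k : ℕ, b ≠ k)
    {N : ℕ} (hNc : N < c) (hcN : c < N + 1) (hbc : b < c) (hx : 0 < x) :
    ∫ y : ℝ, barnesKernel q b (c + y * Complex.I) * (x : ℂ) ^ (c + y * Complex.I : ℂ) =
      2 * Real.pi * (Complex.Gamma q * Complex.Gamma (-b) * gammaRemainder q b N x) := by
  set f : ℝ → ℂ := fun x : ℝ => (gammaRemainder q b N x : ℂ)
  have hM : ∀ y : ℝ, HasMellin f (-(c + y * Complex.I : ℂ))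
      ((Complex.Gamma q * Complex.Gamma (-b))⁻¹ * barnesKernel q b (c + y * Complex.I)) := by
    intro y
    have := hasMellin_gammaRemainder hq hb (s := c + y * Complex.I) (N := N) (by simpa) (by simpa)
      (by simpa)
    refine ⟨this.1, this.2.trans ?_⟩
    rw [barnesKernel, mul_inv]
    ring
  -- The transform is taken at `-s`, so inversion runs along `Re = -c` and the ordinate changes
  -- sign.
  have hM' : ∀ y : ℝ, mellin f (((-c : ℝ) : ℂ) + y * Complex.I) =
      (Complex.Gamma q * Complex.Gamma (-b))⁻¹ *
        barnesKernel q b (c + ((-y : ℝ) : ℂ) * Complex.I) := by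
    intro y
    rw [← (hM (-y)).2]
    congr 1
    push_cast
    ring
  have hinv := mellinInv_mellin_eq (-c) f hx (by simpa using (hM 0).1) ?_ ?_
  · rw [mellinInv] at hinv
    simp_rw [hM'] at hinv
    have h1 : ∀ y : ℝ, (x : ℂ) ^ (-(((-c : ℝ) : ℂ) + y * Complex.I)) •
        ((Complex.Gamma q * Complex.Gamma (-b))⁻¹ *
          barnesKernel q b (c + ((-y : ℝ) : ℂ) * Complex.I)) =
        (fun y : ℝ => (Complex.Gamma q * Complex.Gamma (-b))⁻¹ *
          (barnesKernel q b (c + y * Complex.I) * (x : ℂ) ^ (c + y * Complex.I : ℂ))) (-y) := by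
      intro y
      simp only [smul_eq_mul]
      rw [show -(((-c : ℝ) : ℂ) + y * Complex.I) = c + ((-y : ℝ) : ℂ) * Complex.I by
        push_cast; ring]
      ring
    simp_rw [h1] at hinv
    rw [integral_neg_eq_self (fun y : ℝ => (Complex.Gamma q * Complex.Gamma (-b))⁻¹ *
          (barnesKernel q b (c + y * Complex.I) * (x : ℂ) ^ (c + y * Complex.I : ℂ))),
      integral_const_mul] at hinv
    have n1 : Complex.Gamma q ≠ 0 := Complex.Gamma_ne_zero_of_re_pos (by simpa)
    have n2 : Complex.Gamma (-b) ≠ 0 := Complex.Gamma_ne_zero fun k h =>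
      hb k (by exact_mod_cast neg_injective h)
    have n3 : (Real.pi : ℂ) ≠ 0 := by exact_mod_cast Real.pi_ne_zero
    change _ = f x at hinv
    change _ = 2 * (Real.pi : ℂ) * (_ * f x)
    rw [← hinv, Complex.real_smul]
    set J := ∫ y : ℝ, barnesKernel q b (c + y * Complex.I) * (x : ℂ) ^ (c + y * Complex.I : ℂ)
    push_cast
    field_simp
  · rw [Complex.VerticalIntegrable]
    simp_rw [hM']
    exact ((verticalIntegrable_barnesKernel hq hNc hcN hbc).comp_neg).const_mul _
  · exact Complex.continuous_ofReal.continuousAt.comp (continuousAt_gammaRemainder hq hb0.le hx N)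

/-! ### Evaluation of the Meijer G-function -/

theorem natCast_eq_of_mem_closedBall {k n : ℕ} {r : ℝ} (hr : r < 1)
    (h : (k : ℂ) ∈ Metric.closedBall (n : ℂ) r) : k = n := by
  rw [Metric.mem_closedBall, Complex.dist_eq] at h
  have h1 : ‖(((k : ℤ) - n : ℤ) : ℂ)‖ < 1 := by push_cast; exact h.trans_lt hr
  rw [Complex.norm_intCast] at h1
  have h2 : |(k : ℤ) - n| < 1 := by exact_mod_cast h1
  have := Int.abs_lt_one_iff.1 h2
  omega

/-- In the disc, `Γ(-u)` equals `-Γ(n + 1 - u) / ∏_{j<n} (j - u)` divided by `u - n`, so Cauchy's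
formula applies. The factor `(-1)^n / n!` from the pole and the quotient `Γ(n - b) / Γ(-b)` combine
to the binomial coefficient. -/
theorem circleIntegral_barnesKernel {q b x r : ℝ} (hx : 0 < x) {n : ℕ} (hr0 : 0 < r) (hr1 : r < 1)
    (hq : ∀ u ∈ Metric.closedBall (n : ℂ) r, ∀ k : ℕ, (q : ℂ) + u ≠ -k)
    (hb : ∀ u ∈ Metric.closedBall (n : ℂ) r, ∀ k : ℕ, u - b ≠ -k) (hbn : ∀ k : ℕ, b ≠ k) :
    ∮ u in C((n : ℂ), r), barnesKernel q b u * (x : ℂ) ^ u =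
      -(2 * Real.pi * Complex.I * (Complex.Gamma (-b) *
        (realChoose b n * x ^ n * Complex.Gamma (n + q)))) := by
  set G : ℂ → ℂ := fun u => -(Complex.Gamma (-u + (n + 1 : ℕ)) / ∏ j ∈ Finset.range n, (-u + j)) *
    (Complex.Gamma (q + u) * Complex.Gamma (u - b)) * (x : ℂ) ^ u with hG
  have hprod : ∀ u ∈ Metric.closedBall (n : ℂ) r, ∏ j ∈ Finset.range n, (-u + (j : ℂ)) ≠ 0 := by
    refine fun u hu => Finset.prod_ne_zero_iff.2 fun j hj h => ?_
    have hju : u = j := neg_injective (eq_neg_of_add_eq_zero_left h)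
    rw [hju] at hu
    exact (Finset.mem_range.1 hj).ne (natCast_eq_of_mem_closedBall hr1 hu)
  have hcirc : ∮ u in C((n : ℂ), r), barnesKernel q b u * (x : ℂ) ^ u =
      ∮ u in C((n : ℂ), r), (u - n)⁻¹ • G u := by
    refine circleIntegral.integral_congr hr0.le fun u hu => ?_
    have hu' := Metric.sphere_subset_closedBall hu
    have hun : u ≠ n := fun h => by
      rw [h, Metric.mem_sphere, dist_self] at hu
      exact hr0.ne hu
    have hne : ∀ k : ℕ, -u ≠ -k := fun k h => by
      have hk : u = k := neg_injective h
      have hu2 := hu'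
      rw [hk] at hu2
      exact hun (hk.trans (by rw [natCast_eq_of_mem_closedBall hr1 hu2]))
    simp only [hG, barnesKernel]
    rw [Complex.Gamma_add_natCast hne, Finset.prod_range_succ, smul_eq_mul]
    have h1 := hprod u hu'
    have h2 : u - n ≠ 0 := sub_ne_zero.2 hun
    field_simp
    ring
  have hx0 : (x : ℂ) ≠ 0 := by exact_mod_cast hx.ne'
  have hdiff : DifferentiableOn ℂ G (Metric.closedBall (n : ℂ) r) := by
    intro u hu
    refine DifferentiableAt.differentiableWithinAt ?_
    have hΓ : ∀ {f : ℂ → ℂ}, DifferentiableAt ℂ f u → (∀ m : ℕ, f u ≠ -m) →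
        DifferentiableAt ℂ (fun u => Complex.Gamma (f u)) u := fun hf h =>
      (Complex.differentiableAt_Gamma _ h).comp u hf
    have d1 : DifferentiableAt ℂ (fun u : ℂ => Complex.Gamma (-u + (n + 1 : ℕ))) u := by
      refine hΓ (by fun_prop) fun m h => ?_
      have h1 := congrArg Complex.re h
      have h2 := (Complex.abs_re_le_norm (u - n)).trans (by simpa [Complex.dist_eq] using hu)
      have h3 := (abs_le.1 h2).2
      have := m.cast_nonneg (α := ℝ)
      simp at h1 h3
      linarith
    have d2 := hΓ (f := fun u => q + u) (by fun_prop) (hq u hu)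
    have d3 := hΓ (f := fun u => u - b) (by fun_prop) (hb u hu)
    have d4 : DifferentiableAt ℂ (fun u => (x : ℂ) ^ u) u :=
      differentiableAt_id.const_cpow (Or.inl hx0)
    have d5 : DifferentiableAt ℂ (fun u : ℂ => ∏ j ∈ Finset.range n, (-u + (j : ℂ))) u := by
      fun_prop
    exact (((d1.div d5 (hprod u hu)).neg).mul (d2.mul d3)).mul d4
  rw [hcirc, hdiff.circleIntegral_sub_inv_smul (Metric.mem_ball_self hr0)]
  have hbn' : ∀ k : ℕ, -(b : ℂ) ≠ -k := fun k h => hbn k (by exact_mod_cast neg_injective h)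
  have e1 : ∏ j ∈ Finset.range n, (-(n : ℂ) + j) = (-1) ^ n * n.factorial := by
    have h1 : ∀ m : ℕ, ∏ j ∈ Finset.range m, (-(m : ℂ) + j) = (-1) ^ m * m.factorial := by
      intro m
      rw [← Finset.prod_range_reflect, ← Finset.prod_range_add_one_eq_factorial, Nat.cast_prod]
      rw [show (∏ j ∈ Finset.range m, ((j + 1 : ℕ) : ℂ)) =
        ∏ j ∈ Finset.range m, (-(-1 : ℂ) + j) from
          Finset.prod_congr rfl fun j _ => by push_cast; ring, ← prod_range_sub_natCast]
      refine Finset.prod_congr rfl fun j hj => ?_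
      have hj := Finset.mem_range.1 hj
      rw [Nat.sub_sub, Nat.cast_sub (by omega)]
      push_cast
      ring
    exact h1 n
  have e2 : Complex.Gamma (n - b) =
      (∏ j ∈ Finset.range n, (-(b : ℂ) + j)) * Complex.Gamma (-b) := by
    rw [← Complex.Gamma_add_natCast hbn' n]
    ring_nf
  have e3 : (realChoose b n : ℂ) =
      (-1) ^ n * (∏ j ∈ Finset.range n, (-(b : ℂ) + j)) / n.factorial := by
    rw [← prod_range_sub_natCast, realChoose]
    push_cast
    rfl
  have e4 : ((-1 : ℂ) ^ n) * (-1) ^ n = 1 := by rw [← mul_pow]; simp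
  have n1 : (n.factorial : ℂ) ≠ 0 := by exact_mod_cast n.factorial_ne_zero
  have n2 : (-1 : ℂ) ^ n ≠ 0 := by simp
  simp only [hG, smul_eq_mul]
  rw [e1, e2, e3, Complex.cpow_natCast, Nat.cast_succ, neg_add_cancel_left, Complex.Gamma_one,
    add_comm (q : ℂ)]
  field_simp
  linear_combination (Complex.Gamma (n + q) *
    (∏ j ∈ Finset.range n, (-(b : ℂ) + j)) * Complex.Gamma (-b)) * e4

/-! ### Contours separating the two families of poles -/

section Contour

variable {q b : ℝ}

/-- The left poles of the integrand. -/
abbrev barnesLeft (q b : ℝ) : Set ℂ := meijerLeftPoles 2 ![1 - (q : ℂ), (b : ℂ) + 1]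

/-- The right poles of the integrand. -/
abbrev barnesRight : Set ℂ := meijerRightPoles 1 ![(0 : ℂ)]

theorem mem_barnesLeft {s : ℂ} :
    s ∈ barnesLeft q b ↔ (∃ l : ℕ, s = -q - l) ∨ ∃ l : ℕ, s = b - l := by
  simp [barnesLeft, meijerLeftPoles, Fin.exists_fin_two]

theorem mem_barnesRight {s : ℂ} : s ∈ barnesRight ↔ ∃ l : ℕ, s = l := by
  simp [barnesRight, meijerRightPoles]

theorem meijerIntegrand_eq (z s : ℂ) :
    meijerIntegrand 1 2 ![1 - (q : ℂ), (b : ℂ) + 1] ![0] z s = barnesKernel q b s * z ^ s := by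
  simp only [meijerIntegrand, barnesKernel, Fin.prod_univ_two, Fin.prod_univ_one]
  simp
  refine Or.inl (Or.inl (Or.inl ?_))
  congr 1
  ring

/-- An arbitrary contour is treated because `meijerG` selects one by choice. The line gives the
remainder of order `⌊c⌋`, the clockwise circles add back the Taylor terms. -/
theorem meijerContour_integral (K : MeijerContour (barnesLeft q b) barnesRight) (hq : 0 < q)
    (hb0 : 0 < b) (hb : ∀ k : ℕ, b ≠ k) {x : ℝ} (hx : 0 < x) :
    K.integral (meijerIntegrand 1 2 ![1 - (q : ℂ), (b : ℂ) + 1] ![0] x) =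
      ((Real.Gamma q * Real.Gamma (-b) *
        ∫ g in Set.Ioi (0 : ℝ), gammaWeight q g * (1 + x * g) ^ b : ℝ) : ℂ) := by
  have hbc : b < K.c := by simpa using K.left_lt b (mem_barnesLeft.2 (Or.inr ⟨0, by simp⟩))
  have hc : 0 < K.c := hb0.trans hbc
  set N := ⌊K.c⌋₊
  have hNc : (N : ℝ) < K.c := lt_of_le_of_ne (Nat.floor_le hc.le)
    (by simpa using K.right_ne N (mem_barnesRight.2 ⟨N, rfl⟩))
  have hcN : K.c < N + 1 := Nat.lt_floor_add_one _
  have hmem : ∀ n : ℕ, n < N + 1 → (n : ℂ) ∈ K.enclosed := fun n hn => by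
    rw [K.mem_enclosed]
    refine ⟨mem_barnesRight.2 ⟨n, rfl⟩, ?_⟩
    rw [Complex.natCast_re]
    exact lt_of_le_of_lt (by exact_mod_cast Nat.lt_succ_iff.1 hn) hNc
  have henc : K.enclosed = (Finset.range (N + 1)).image (fun n : ℕ => (n : ℂ)) := by
    ext s
    rw [Finset.mem_image]
    constructor
    · intro hs
      obtain ⟨hR, hlt⟩ := (K.mem_enclosed s).1 hs
      obtain ⟨l, rfl⟩ := mem_barnesRight.1 hR
      rw [Complex.natCast_re] at hlt
      exact ⟨l, Finset.mem_range.2 (by exact_mod_cast hlt.trans hcN), rfl⟩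
    · rintro ⟨n, hn, rfl⟩
      exact hmem n (Finset.mem_range.1 hn)
  -- The enclosed pole `0` is isolated from the right pole `1`.
  have hr1 : K.r < 1 := by
    simpa using K.isolated_right _ (hmem 0 (Nat.succ_pos _)) 1 (mem_barnesRight.2 ⟨1, by simp⟩)
      (by simp)
  have hres : ∀ n ∈ Finset.range (N + 1), ∮ u in C((n : ℂ), K.r),
      barnesKernel q b u * (x : ℂ) ^ u = -(2 * Real.pi * Complex.I * (Complex.Gamma (-b) *
        (realChoose b n * x ^ n * Complex.Gamma (n + q)))) := fun n hn => by
    have hL := K.isolated_left _ (hmem n (Finset.mem_range.1 hn))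
    refine circleIntegral_barnesKernel hx K.r_pos hr1 (fun u hu k h => ?_) (fun u hu k h => ?_) hb
    · exact (hL u (mem_barnesLeft.2 (Or.inl ⟨k, by linear_combination h⟩))).not_ge hu
    · exact (hL u (mem_barnesLeft.2 (Or.inr ⟨k, by linear_combination h⟩))).not_ge hu
  rw [MeijerContour.integral]
  simp_rw [meijerIntegrand_eq]
  rw [integral_mul_const, integral_barnesKernel hq hb0 hb hNc hcN hbc hx, henc,
    Finset.sum_image (fun _ _ _ _ h => Nat.cast_injective h), Finset.sum_congr rfl hres,
    gammaRemainder_eq hq hb0.le hx.le]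
  have hΓ : (Real.Gamma q : ℂ) ≠ 0 := by exact_mod_cast (Real.Gamma_pos_of_pos hq).ne'
  have n3 : (Real.pi : ℂ) ≠ 0 := by exact_mod_cast Real.pi_ne_zero
  set J := ∫ g in Set.Ioi (0 : ℝ), gammaWeight q g * (1 + x * g) ^ b
  have hsum : (Complex.Gamma q) * ((∑ l ∈ Finset.range (N + 1), realChoose b l * x ^ l *
        (Real.Gamma (l + q) / Real.Gamma q) : ℝ) : ℂ) =
      ∑ l ∈ Finset.range (N + 1), (realChoose b l * x ^ l * Complex.Gamma (l + q) : ℂ) := by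
    push_cast
    rw [Finset.mul_sum]
    refine Finset.sum_congr rfl fun l _ => ?_
    rw [Complex.Gamma_ofReal, show (l : ℂ) + q = ((l + q : ℝ) : ℂ) by push_cast; rfl,
      Complex.Gamma_ofReal]
    field_simp
  rw [Finset.sum_neg_distrib, ← Finset.mul_sum, ← Finset.mul_sum, ← hsum, Complex.ofReal_sub,
    ← Complex.ofReal_neg, Complex.Gamma_ofReal, Complex.Gamma_ofReal, Complex.ofReal_mul,
    Complex.ofReal_mul]
  field_simp
  ring

theorem exists_meijerContour (hq : 0 < q) (hb0 : 0 < b) (hb : ∀ k : ℕ, b ≠ k) {x : ℝ}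
    (hx : 0 < x) : ∃ K : MeijerContour (barnesLeft q b) barnesRight, Complex.VerticalIntegrable
      (meijerIntegrand 1 2 ![1 - (q : ℂ), (b : ℂ) + 1] ![0] x) K.c := by
  set N := ⌊b⌋₊
  have hNb : (N : ℝ) < b := lt_of_le_of_ne (Nat.floor_le hb0.le) (hb N).symm
  have hbN : b < N + 1 := Nat.lt_floor_add_one _
  obtain ⟨c, hbc, hcN⟩ := exists_between hbN
  have hbz : ∀ m : ℤ, b ≠ m := fun m h => by
    have hm : 0 ≤ m := by
      have : (0 : ℝ) < m := h ▸ hb0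
      exact_mod_cast this.le
    lift m to ℕ using hm
    exact hb m (by simpa using h)
  have hround : 0 < |b - round b| := abs_pos.2 (sub_ne_zero.2 (hbz _))
  -- Lower bounds for the distance of a natural number to the poles `-q - l`, to the poles `b - l`,
  -- and to the other right poles.
  set ρ : ℝ := min (min q |b - round b|) 1
  have hρ : 0 < ρ := lt_min (lt_min hq hround) one_pos
  have hρ2 : ρ / 2 < ρ := half_lt_self hρ
  have henc : ∀ s, s ∈ (Finset.range (N + 1)).image (fun n : ℕ => (n : ℂ)) ↔
      s ∈ barnesRight ∧ s.re < c := fun s => by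
    rw [Finset.mem_image, mem_barnesRight]
    constructor
    · rintro ⟨n, hn, rfl⟩
      refine ⟨⟨n, rfl⟩, ?_⟩
      rw [Complex.natCast_re]
      have : (n : ℝ) ≤ N := by exact_mod_cast Nat.lt_succ_iff.1 (Finset.mem_range.1 hn)
      linarith
    · rintro ⟨⟨l, rfl⟩, hl⟩
      rw [Complex.natCast_re] at hl
      exact ⟨l, Finset.mem_range.2 (by exact_mod_cast hl.trans hcN), rfl⟩
  refine ⟨⟨c, ?_, ?_, _, henc, ρ / 2, half_pos hρ, ?_, ?_⟩, ?_⟩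
  · intro s hs
    rcases mem_barnesLeft.1 hs with ⟨l, rfl⟩ | ⟨l, rfl⟩
    · have := l.cast_nonneg (α := ℝ)
      simp
      linarith
    · have := l.cast_nonneg (α := ℝ)
      simp
      linarith
  · intro s hs h
    obtain ⟨l, rfl⟩ := mem_barnesRight.1 hs
    rw [Complex.natCast_re] at h
    rw [← h] at hbc hcN
    have h1 : N < l := by exact_mod_cast hNb.trans hbc
    have h2 : l < N + 1 := by exact_mod_cast hcN
    omega
  · intro s hs u hu
    obtain ⟨n, -, rfl⟩ := Finset.mem_image.1 hs
    refine hρ2.trans_le ?_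
    rw [Complex.dist_eq]
    rcases mem_barnesLeft.1 hu with ⟨l, rfl⟩ | ⟨l, rfl⟩
    · refine ((min_le_left _ _).trans (min_le_left _ _)).trans ?_
      refine le_trans ?_ (Complex.abs_re_le_norm _)
      rw [le_abs]
      right
      have := l.cast_nonneg (α := ℝ)
      have := n.cast_nonneg (α := ℝ)
      simp
      linarith
    · refine ((min_le_left _ _).trans (min_le_right _ _)).trans ?_
      refine le_trans ?_ (Complex.abs_re_le_norm _)
      have := round_le b ((l : ℤ) + n)
      push_cast at this
      simpa [sub_sub] using this
  · intro s hs u hu hne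
    obtain ⟨n, -, rfl⟩ := Finset.mem_image.1 hs
    obtain ⟨k, rfl⟩ := mem_barnesRight.1 hu
    refine hρ2.trans_le ((min_le_right _ _).trans ?_)
    by_contra hlt
    rw [not_le] at hlt
    exact hne (by rw [natCast_eq_of_mem_closedBall hlt (Metric.mem_closedBall.2 le_rfl)])
  · have hv := verticalIntegrable_barnesKernel hq (hNb.trans hbc) hcN hbc
    have hx0 : (x : ℂ) ≠ 0 := by exact_mod_cast hx.ne'
    rw [Complex.VerticalIntegrable] at hv ⊢
    simp_rw [meijerIntegrand_eq]
    refine (hv.norm.mul_const (x ^ c)).mono' (hv.aestronglyMeasurable.mul ?_)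
      (.of_forall fun y => ?_)
    · refine Continuous.aestronglyMeasurable ?_
      exact (by fun_prop : Continuous fun y : ℝ => (c + y * Complex.I : ℂ)).const_cpow (Or.inl hx0)
    · rw [norm_mul, Complex.norm_cpow_eq_rpow_re_of_pos hx]
      simp

theorem meijerG_eq_integral (hq : 0 < q) (hb0 : 0 < b) (hb : ∀ k : ℕ, b ≠ k) {x : ℝ}
    (hx : 0 < x) : meijerG 1 2 ![1 - (q : ℂ), (b : ℂ) + 1] ![0] x =
      ((Real.Gamma q * Real.Gamma (-b) *
        ∫ g in Set.Ioi (0 : ℝ), gammaWeight q g * (1 + x * g) ^ b : ℝ) : ℂ) := by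
  rw [meijerG, dif_pos (exists_meijerContour hq hb0 hb hx)]
  exact meijerContour_integral _ hq hb0 hb hx

end Contour

/-! ### The moment formulas -/

theorem proposition2 {Ω : Type*} [MeasurableSpace Ω] (μ : Measure Ω) [IsProbabilityMeasure μ]
    (h : ℂ) (P : ℝ≥0) (σ q γ : ℝ) (hP : 0 < P) (hσ : 0 < σ) (hq : 0 < q)
    (hγ : γ = ‖h‖ ^ 2 * P / σ ^ 2)
    (s w : Ω → ℂ) (hs : HasLaw s (complexGaussian P) μ) (hw : HasLaw w (mcLeish σ q) μ)
    (hsw : IndepFun s w μ) :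
    (h ≠ 0 → ∀ p : ℝ, 0 < p → (∀ k : ℕ, p ≠ 2 * k) →
      Integrable (fun ω => ‖h * s ω + w ω‖ ^ p) μ ∧
      ((∫ ω, ‖h * s ω + w ω‖ ^ p ∂μ : ℝ) : ℂ) =
        ((Real.Gamma (1 + p / 2) * (‖h‖ ^ 2 * P) ^ (p / 2) /
            (Real.Gamma q * Real.Gamma (-(p / 2))) : ℝ) : ℂ) *
          meijerG 1 2 ![1 - (q : ℂ), (p : ℂ) / 2 + 1] ![0] (1 / ((γ : ℂ) * q))) ∧
    (∀ m : ℕ, 1 ≤ m →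
      Integrable (fun ω => ‖h * s ω + w ω‖ ^ (2 * m)) μ ∧
      ∫ ω, ‖h * s ω + w ω‖ ^ (2 * m) ∂μ =
        Real.Gamma (1 + m) / Real.Gamma q *
          ∑ k ∈ Finset.range (m + 1), (m.choose k : ℝ) * (‖h‖ ^ 2 * P) ^ (m - k) * σ ^ (2 * k) *
            Real.Gamma (k + q) * (q ^ k)⁻¹) := by
  refine ⟨fun hh p hp hpk => ?_, fun m hm => even_moment_norm_add hσ hq hs hw hsw hm⟩
  obtain ⟨hint, hval⟩ := moment_norm_add (h := h) hσ hq hs hw hsw hp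
  refine ⟨hint, ?_⟩
  have hb : ∀ k : ℕ, p / 2 ≠ k := fun k hk => hpk k (by linarith)
  have hA : 0 < ‖h‖ ^ 2 * P := by
    have := norm_pos_iff.2 hh
    positivity
  have hγ0 : 0 < γ := by rw [hγ]; positivity
  have hG := meijerG_eq_integral hq (half_pos hp) hb (x := 1 / (γ * q)) (by positivity)
  push_cast at hG
  rw [hG, hval]
  -- Factoring out `|h|² P`, which is positive as `h ≠ 0`, leaves the coefficient `σ² / (q |h|² P) =
  -- 1 / (γ q)`.
  have hscale : ∫ g in Set.Ioi (0 : ℝ), gammaWeight q g *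
      (‖h‖ ^ 2 * P + σ ^ 2 / q * g) ^ (p / 2) = (‖h‖ ^ 2 * P) ^ (p / 2) *
        ∫ g in Set.Ioi (0 : ℝ), gammaWeight q g * (1 + 1 / (γ * q) * g) ^ (p / 2) := by
    rw [← integral_const_mul]
    refine setIntegral_congr_fun measurableSet_Ioi fun g hg => ?_
    have hg : 0 < g := hg
    rw [mul_left_comm, ← Real.mul_rpow hA.le (by positivity), hγ]
    congr 2
    field_simp
  rw [hscale]
  have n1 : Real.Gamma q ≠ 0 := (Real.Gamma_pos_of_pos hq).ne'
  have n2 : Real.Gamma (-(p / 2)) ≠ 0 := Real.Gamma_ne_zero fun m h => hb m (neg_injective h)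
  norm_cast
  field_simp
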